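/- Let $\Omega\subset\mathbb R^n$ be a bounded open set, let $1<p_i<\infty$ for $i=1,\dots,n$ with $\sum_{i=1}^n \frac1{p_i}>1$, and define $p$ by $\frac1p=\frac1n\sum_{i=1}^n\frac1{p_i}$ (so $1<p<n$), $p^*=\frac{np}{n-p}$, $p'=\frac p{p-1}$, $n'=\frac n{n-1}$. Let $V:\Omega\times\mathbb R\to\mathbb R$ be such that $V(\cdot,\sigma)\in L^\infty(\Omega)$ for every $\sigma\in\mathbb R$ and, for a.e. $x\in\Omega$, $V(x,\cdot)$ is continuous and nondecreasing with $V(x,0)=0$. Let $T_k(\sigma)=\frac12(|k+\sigma|-|k-\sigma|)$, let $W^{1,1}_0(\Omega)$ be the closure of $C_c^\infty(\Omega)$ in $W^{1,1}(\Omega)$, and let $W^{1,\vec p}_0(\Omega)=\{\varphi\in W^{1,1}_0(\Omega):\partial_i\varphi\in L^{p_i}(\Omega),\ i=1,\dots,n\}$. Let $\mathbb S^{1,\vec p}_0(\Omega)$ be the set of measurable $v:\Omega\to\mathbb R$ such that $\arctan v\in W^{1,1}_0(\Omega)$, $T_k(v)\in W_0^{1,\vec p}(\Omega)$ for all $k>0$,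 and $\sup_{k>0}\max_i k^{-1/p_i}\|\partial_iT_k(v)\|_{L^{p_i}(\Omega)}<\infty$. For $v\in\mathbb S_0^{1,\vec p}(\Omega)$, $\nabla v=(\partial_1v,\dots,\partial_nv)$ denotes the a.e. unique measurable vector field with $\nabla T_k(v)=\mathbf 1_{\{|v|<k\}}\nabla v$ for all $k>0$. For $f\in L^1(\Omega)$, an entropic-renormalized solution of $$-\sum_{i=1}^n\partial_i\big(|\partial_iu|^{p_i-2}\partial_iu\big)+V(x,u)=f\ \text{ in }\Omega,\qquad u=0\ \text{ on }\partial\Omega,$$ is a function $u\in\mathbb S^{1,\vec p}_0(\Omega)$ with $V(\cdot,u)\in L^1(\Omega)$ such that, for all $\eta\in W^{1,\infty}(\Omega)$, all $\varphi\in W_0^{1,\vec p}(\Omega)\cap L^\infty(\Omega)$ and all $B\in W^{1,\infty}(\mathbb R)$ with $B(0)=0$ and $B'(\sigma)=0$ for $|\sigma|\ge\sigma_0$ (for some $\sigma_0>0$), the first integrand below is integrable and $$\int_\Omega\sum_{i=1}^n|\partial_iu|^{p_i-2}\partial_iu\;\partial_i\big(\eta B(u-\varphi)\big)\,dx+\int_\Omega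 V(x,u)\,\eta B(u-\varphi)\,dx=\int_\Omega f\,\eta B(u-\varphi)\,dx.$$ Then there is a constant $c>0$, independent of $u$ and $f$, such that for every $f\in L^1(\Omega)$ and every entropic-renormalized solution $u$ of this problem: 1. $\operatorname{meas}\{x\in\Omega:|u(x)|>k\}\le c\,\|f\|_{L^1(\Omega)}^{p^*/p}\,k^{-p^*/p'}$ for all $k>0$; 2. $\displaystyle\|\partial_iu\|_{L^{q_i,\infty}(\Omega)}\le c\,\|f\|_{L^1(\Omega)}^{p'/p_i}$ with $q_i=\frac{n'p_i}{p'}$, for $i=1,\dots,n$. Here $\|v\|_{L^{q,\infty}(\Omega)}=\sup_{t>0}t\,\operatorname{meas}\{x\in\Omega:|v(x)|>t\}^{1/q}$; if $q_i>1$, (2) also holds for the Lorentz norm $\sup_{0<t<|\Omega|}t^{1/q_i}v_{**}(t)$, where $v_{**}(t)=\frac1t\int_0^tv_*(s)\,ds$ and $v_*$ is the decreasing rearrangement of $|v|$. -/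

import Mathlib

open MeasureTheory Filter Topology
open scoped ENNReal NNReal ContDiff

noncomputable section

namespace Anisotropic

/-- `ℝⁿ` with its Euclidean norm and Lebesgue measure. -/
abbrev Rn (n : ℕ) : Type := EuclideanSpace ℝ (Fin n)

/-- The classical partial derivative `∂ᵢ φ`. -/
def pderiv {n : ℕ} (i : Fin n) (φ : Rn n → ℝ) (x : Rn n) : ℝ :=
  fderiv ℝ φ x (EuclideanSpace.single i 1)

/-- `φ ∈ C_c^∞(Ω)`. -/
structure IsTestFunction {n : ℕ} (Ω : Set (Rn n)) (φ : Rn n → ℝ) : Prop where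
  smooth : ContDiff ℝ ∞ φ
  compact : HasCompactSupport φ
  support : tsupport φ ⊆ Ω

/-- `w` is the weak (distributional) derivative `∂ᵢ v` in the open set `Ω`. Functions are total,
but only their values on `Ω`, up to null sets, matter. -/
structure HasWeakDeriv {n : ℕ} (Ω : Set (Rn n)) (i : Fin n) (v w : Rn n → ℝ) : Prop where
  locallyIntegrable : LocallyIntegrableOn v Ω volume
  locallyIntegrable_deriv : LocallyIntegrableOn w Ω volume
  integral_eq : ∀ φ : Rn n → ℝ, IsTestFunction Ω φ →
    ∫ x in Ω, v x * pderiv i φ x = - ∫ x in Ω, w x * φ x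

/-- `v ∈ W₀^{1,1}(Ω)` with weak gradient `g`: `v` lies in the closure of `C_c^∞(Ω)` in
`W^{1,1}(Ω)`. -/
structure MemW11Zero {n : ℕ} (Ω : Set (Rn n)) (v : Rn n → ℝ) (g : Fin n → Rn n → ℝ) :
    Prop where
  memLp : MemLp v 1 (volume.restrict Ω)
  memLp_grad : ∀ i, MemLp (g i) 1 (volume.restrict Ω)
  hasWeakDeriv : ∀ i, HasWeakDeriv Ω i v (g i)
  approx : ∃ φ : ℕ → Rn n → ℝ, (∀ j, IsTestFunction Ω (φ j)) ∧
    Tendsto (fun j => eLpNorm (fun x => φ j x - v x) 1 (volume.restrict Ω)) atTop (𝓝 0) ∧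
    ∀ i, Tendsto (fun j => eLpNorm (fun x => pderiv i (φ j) x - g i x) 1 (volume.restrict Ω))
      atTop (𝓝 0)

/-- `v ∈ W₀^{1,p⃗}(Ω)` with weak gradient `g`: `v ∈ W₀^{1,1}(Ω)` and `∂ᵢ v ∈ L^{pᵢ}(Ω)`. -/
structure MemW1pZero {n : ℕ} (Ω : Set (Rn n)) (p : Fin n → ℝ) (v : Rn n → ℝ)
    (g : Fin n → Rn n → ℝ) : Prop where
  memW11Zero : MemW11Zero Ω v g
  memLp_grad : ∀ i, MemLp (g i) (ENNReal.ofReal (p i)) (volume.restrict Ω)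

/-- `η ∈ W^{1,∞}(Ω)`. -/
def MemW1Inf {n : ℕ} (Ω : Set (Rn n)) (η : Rn n → ℝ) : Prop :=
  MemLp η ∞ (volume.restrict Ω) ∧
    ∀ i, ∃ w : Rn n → ℝ, HasWeakDeriv Ω i η w ∧ MemLp w ∞ (volume.restrict Ω)

/-- The truncation `T_k`. -/
def trunc (k σ : ℝ) : ℝ := (|k + σ| - |k - σ|) / 2

/-- `u` belongs to the `T`-space `𝕊₀^{1,p⃗}(Ω)`: `u` is measurable, `arctan u ∈ W₀^{1,1}(Ω)`,
`T_k(u) ∈ W₀^{1,p⃗}(Ω)` for every `k > 0`, and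
`sup_{k > 0} max_i k^{-1/pᵢ} ‖∂ᵢ T_k(u)‖_{L^{pᵢ}} < ∞`. -/
structure MemTSpace {n : ℕ} (Ω : Set (Rn n)) (p : Fin n → ℝ) (u : Rn n → ℝ) : Prop where
  measurable : AEMeasurable u (volume.restrict Ω)
  arctan_mem : ∃ g, MemW11Zero Ω (fun x => Real.arctan (u x)) g
  trunc_mem : ∃ C : ℝ≥0, ∀ k : ℝ, 0 < k → ∃ g, MemW1pZero Ω p (fun x => trunc k (u x)) g ∧
    ∀ i, ENNReal.ofReal (k ^ (-(1 / p i))) *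
      eLpNorm (g i) (ENNReal.ofReal (p i)) (volume.restrict Ω) ≤ C

/-- `G` is the generalized gradient of the measurable function `u`: for every `k > 0` the weak
gradient of `T_k(u)` is `1_{|u| < k} G`. This determines `G` almost everywhere in `Ω`. -/
def HasGenGrad {n : ℕ} (Ω : Set (Rn n)) (u : Rn n → ℝ) (G : Fin n → Rn n → ℝ) : Prop :=
  ∀ i, AEMeasurable (G i) (volume.restrict Ω) ∧ ∀ k : ℝ, 0 < k →
    HasWeakDeriv Ω i (fun x => trunc k (u x)) ({x | |u x| < k}.indicator (G i))

open Classical in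
/-- The gradient `(∂₁ u, …, ∂ₙ u)` of a function of the `T`-space, in the generalized sense
(such a gradient exists for every element of the `T`-space and is unique almost everywhere;
it is the weak gradient if `u` is weakly differentiable). -/
def genGrad {n : ℕ} (Ω : Set (Rn n)) (u : Rn n → ℝ) : Fin n → Rn n → ℝ :=
  if h : ∃ G, HasGenGrad Ω u G then h.choose else 0

/-- The hypotheses on the potential: `V(·, σ) ∈ L^∞(Ω)` for every `σ`, and for almost every
`x ∈ Ω` the function `V(x, ·)` is continuous and nondecreasing with `V(x, 0) = 0`. -/
structure IsPotential {n : ℕ} (Ω : Set (Rn n)) (V : Rn n → ℝ → ℝ) : Prop where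
  bounded : ∀ σ : ℝ, MemLp (fun x => V x σ) ∞ (volume.restrict Ω)
  monotone : ∀ᵐ x ∂(volume.restrict Ω), Continuous (V x) ∧ Monotone (V x) ∧ V x 0 = 0

/-- `B ∈ W^{1,∞}(ℝ)` (that is, `B` is bounded and Lipschitz), `B(0) = 0`, and `B'(σ) = 0`
for `|σ| ≥ σ₀`, for some `σ₀ > 0`. -/
structure IsRenormalization (B : ℝ → ℝ) : Prop where
  lipschitz : ∃ K : ℝ≥0, LipschitzWith K B
  bounded : ∃ M : ℝ, ∀ σ, |B σ| ≤ M
  zero : B 0 = 0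
  deriv_zero : ∃ σ₀ : ℝ, 0 < σ₀ ∧ ∀ σ, σ₀ ≤ |σ| → HasDerivAt B 0 σ

/-- The `i`-th component `|ξᵢ|^{pᵢ-2} ξᵢ` of the anisotropic vector field. -/
def flux {n : ℕ} (p : Fin n → ℝ) (i : Fin n) (ξ : ℝ) : ℝ := |ξ| ^ (p i - 2) * ξ

/-- `u` is an entropic-renormalized solution of the Dirichlet problem
`-∑ᵢ ∂ᵢ(|∂ᵢ u|^{pᵢ-2} ∂ᵢ u) + V(x, u) = f` in `Ω`, `u = 0` on `∂Ω`. In the identity, `D` is the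
(almost everywhere unique) weak gradient of `η B(u - φ)`. -/
structure IsEntropicRenormalizedSolution {n : ℕ} (Ω : Set (Rn n)) (p : Fin n → ℝ)
    (V : Rn n → ℝ → ℝ) (f u : Rn n → ℝ) : Prop where
  memTSpace : MemTSpace Ω p u
  integrable_potential : IntegrableOn (fun x => V x (u x)) Ω volume
  identity : ∀ η φ : Rn n → ℝ, ∀ B : ℝ → ℝ, ∀ D : Fin n → Rn n → ℝ,
    MemW1Inf Ω η →
    (∃ g, MemW1pZero Ω p φ g) → MemLp φ ∞ (volume.restrict Ω) →
    IsRenormalization B →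
    (∀ i, HasWeakDeriv Ω i (fun x => η x * B (u x - φ x)) (D i)) →
    IntegrableOn (fun x => ∑ i, flux p i (genGrad Ω u i x) * D i x) Ω volume ∧
    (∫ x in Ω, ∑ i, flux p i (genGrad Ω u i x) * D i x)
        + ∫ x in Ω, V x (u x) * (η x * B (u x - φ x))
      = ∫ x in Ω, f x * (η x * B (u x - φ x))

/-- The harmonic mean `p` of `p₁, …, pₙ`: `1/p = (1/n) ∑ᵢ 1/pᵢ`. -/
def hmean {n : ℕ} (p : Fin n → ℝ) : ℝ := (n : ℝ) / ∑ i, 1 / p i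

/-- The Sobolev exponent `p* = np/(n-p)`. -/
def sobolevExp (n : ℕ) (q : ℝ) : ℝ := n * q / (n - q)

/-- The conjugate exponent `q' = q/(q-1)`. -/
def conjExp (q : ℝ) : ℝ := q / (q - 1)

/-- The Marcinkiewicz quasi-norm `sup_{t > 0} t |{x ∈ Ω : |v(x)| > t}|^{1/q}` of
`L^{q,∞}(Ω)`, `0 < q < ∞`. -/
def weakNorm {n : ℕ} (Ω : Set (Rn n)) (q : ℝ) (v : Rn n → ℝ) : ℝ≥0∞ :=
  ⨆ (t : ℝ) (_ : 0 < t), ENNReal.ofReal t * volume {x ∈ Ω | t < |v x|} ^ (1 / q)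

/-- The decreasing rearrangement `v_*` of `|v|`. -/
def rearr {n : ℕ} (Ω : Set (Rn n)) (v : Rn n → ℝ) (s : ℝ) : ℝ≥0∞ :=
  sInf {t : ℝ≥0∞ | volume {x ∈ Ω | t ≤ ENNReal.ofReal |v x|} ≤ ENNReal.ofReal s}

/-- The maximal function `v_**(t) = (1/t) ∫₀ᵗ v_*(s) ds`. -/
def rearrAvg {n : ℕ} (Ω : Set (Rn n)) (v : Rn n → ℝ) (t : ℝ) : ℝ≥0∞ :=
  ENNReal.ofReal (1 / t) * ∫⁻ s in Set.Ioo 0 t, rearr Ω v s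

/-- The Lorentz norm `sup_{0 < t < |Ω|} t^{1/q} v_**(t)` of `L^{q,∞}(Ω)`, `1 < q < ∞`. -/
def lorentzNorm {n : ℕ} (Ω : Set (Rn n)) (q : ℝ) (v : Rn n → ℝ) : ℝ≥0∞ :=
  ⨆ (t : ℝ) (_ : 0 < t ∧ ENNReal.ofReal t < volume Ω),
    ENNReal.ofReal (t ^ (1 / q)) * rearrAvg Ω v t

end Anisotropic

end

/-! Write `S = ∑ 1 / p i`, so that `p = n / S`, `p* = n / (S - 1)`, `p* / p = S / (S - 1)` and `p* /
p' = (n - S) / (S - 1)`. Only the truncations `T_k(u)` enter the estimates, and everything follows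
from two bounds on them.

Energy (`energy_le`). Testing with `η = 1`, `φ = 0`, `B = T_k`, the potential term is nonnegative
because `V(x, ·)` is monotone and vanishes at `0`. Hence `∫_{|u| < k} |∂ᵢ u|^{pᵢ} ≤ k ‖f‖₁` for each
`i`.

Anisotropic Sobolev inequality (`MemW11Zero.lintegral_rpow_le`). If `∫ |∂ᵢ v|^{pᵢ} ≤ A` for all `i`
and `v` is bounded, then `∫ |v|^{p*} ≤ C A^{p*/p}`. It comes from Gagliardo's argument with a
different power of `v` in each coordinate direction, Hölder's inequality, and absorption of a power
of `∫ |v|^{p*}`.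

With `v = T_k(u)` and `A = k ‖f‖₁`, Chebyshev's inequality gives the decay of `|{|u| ≥ k}|`
(`volume_level_le`). For the gradient, `{|∂ᵢ u| > t}` is covered by `{|u| ≥ k}` and `{|u| < k, |∂ᵢ
u| ≥ t}`; the first is small for large `k`, the second has measure at most `k ‖f‖₁ / t^{pᵢ}`, and
the optimal `k` balances the two (`volume_grad_le`). The weak and Lorentz norms are then read off
from the distribution function.

The preliminary work is the chain rule for truncations in `W₀^{1,1}(Ω)`, which makes the gradients
of the various `T_k(u)` compatible, so that a generalized gradient exists. -/

namespace Anisotropic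

variable {n : ℕ} {Ω : Set (Rn n)}

/-! ### Test functions -/

section TestFunctions

variable {φ ψ : Rn n → ℝ}

lemma IsTestFunction.contDiff_one (h : IsTestFunction Ω φ) : ContDiff ℝ 1 φ :=
  h.smooth.of_le (by exact_mod_cast le_top)

lemma IsTestFunction.continuous (h : IsTestFunction Ω φ) : Continuous φ :=
  h.smooth.continuous

lemma IsTestFunction.continuous_pderiv (h : IsTestFunction Ω φ) (i : Fin n) :
    Continuous (pderiv i φ) :=
  (h.contDiff_one.continuous_fderiv one_ne_zero).clm_apply continuous_const

lemma IsTestFunction.hasCompactSupport_pderiv (h : IsTestFunction Ω φ) (i : Fin n) :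
    HasCompactSupport (pderiv i φ) :=
  h.compact.fderiv_apply ℝ (EuclideanSpace.single i 1)

lemma IsTestFunction.eq_zero_of_notMem (h : IsTestFunction Ω φ) {x : Rn n} (hx : x ∉ Ω) :
    φ x = 0 :=
  image_eq_zero_of_notMem_tsupport fun h' => hx (h.support h')

lemma IsTestFunction.pderiv_eq_zero_of_notMem (h : IsTestFunction Ω φ) (i : Fin n) {x : Rn n}
    (hx : x ∉ Ω) : pderiv i φ x = 0 := by
  have : x ∉ tsupport φ := fun h' => hx (h.support h')
  rw [pderiv, fderiv_of_notMem_tsupport ℝ this]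
  rfl

lemma IsTestFunction.exists_bound (h : IsTestFunction Ω φ) : ∃ C, ∀ x, |φ x| ≤ C :=
  h.compact.exists_bound_of_continuous h.continuous

lemma IsTestFunction.exists_bound_pderiv (h : IsTestFunction Ω φ) (i : Fin n) :
    ∃ C, ∀ x, |pderiv i φ x| ≤ C :=
  (h.hasCompactSupport_pderiv i).exists_bound_of_continuous (h.continuous_pderiv i)

/-- Integration by parts for a `C¹` function of a test function. -/
lemma integral_comp_mul_pderiv {S S' : ℝ → ℝ} (hS : ∀ σ, HasDerivAt S (S' σ) σ)
    (hS' : Continuous S') (hφ : IsTestFunction Ω φ) (hψ : IsTestFunction Ω ψ) (i : Fin n) :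
    ∫ x in Ω, S (φ x) * pderiv i ψ x = - ∫ x in Ω, S' (φ x) * pderiv i φ x * ψ x := by
  rw [setIntegral_eq_integral_of_forall_compl_eq_zero
      fun x hx => by rw [hψ.pderiv_eq_zero_of_notMem i hx, mul_zero],
    setIntegral_eq_integral_of_forall_compl_eq_zero
      fun x hx => by rw [hψ.eq_zero_of_notMem hx, mul_zero]]
  have hSc : Continuous S := continuous_iff_continuousAt.2 fun σ => (hS σ).continuousAt
  have hd : ∀ x, HasFDerivAt (fun x => S (φ x)) (S' (φ x) • fderiv ℝ φ x) x := fun x =>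
    (hS (φ x)).comp_hasFDerivAt x
      (hφ.contDiff_one.differentiable one_ne_zero x).hasFDerivAt
  have he : ∀ x, S' (φ x) * pderiv i φ x =
      fderiv ℝ (fun x => S (φ x)) x (EuclideanSpace.single i 1) := fun x => by
    rw [(hd x).fderiv]; rfl
  simp_rw [he]
  refine integral_mul_fderiv_eq_neg_fderiv_mul_of_integrable ?_ ?_ ?_
    (fun x _ => (hd x).differentiableAt)
    (fun x _ => hψ.contDiff_one.differentiable one_ne_zero x)
  · simp_rw [← he]
    exact (((hS'.comp hφ.continuous).mul (hφ.continuous_pderiv i)).mul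
      hψ.continuous).integrable_of_hasCompactSupport hψ.compact.mul_left
  · exact ((hSc.comp hφ.continuous).mul (hψ.continuous_pderiv i)).integrable_of_hasCompactSupport
      (hψ.hasCompactSupport_pderiv i).mul_left
  · exact ((hSc.comp hφ.continuous).mul hψ.continuous).integrable_of_hasCompactSupport
      hψ.compact.mul_left

end TestFunctions

/-! ### Convergence in `L¹` -/

section Convergence

variable {α : Type*} {m : MeasurableSpace α} {μ : Measure α}

/-- The product of a bounded sequence converging almost everywhere and of a sequence converging in
`L¹` converges in `L¹`. -/
lemma tendsto_eLpNorm_one_mul {a : ℕ → α → ℝ} {a₀ : α → ℝ} {b : ℕ → α → ℝ} {b₀ : α → ℝ} {K : ℝ}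
    (ha : ∀ j, AEStronglyMeasurable (a j) μ) (haK : ∀ j x, |a j x| ≤ K)
    (haK₀ : ∀ x, |a₀ x| ≤ K)
    (hlim : ∀ᵐ x ∂μ, Tendsto (fun j => a j x) atTop (𝓝 (a₀ x)))
    (hb : ∀ j, AEStronglyMeasurable (b j) μ) (hb₀ : Integrable b₀ μ)
    (hbl : Tendsto (fun j => eLpNorm (fun x => b j x - b₀ x) 1 μ) atTop (𝓝 0)) :
    Tendsto (fun j => eLpNorm (fun x => a j x * b j x - a₀ x * b₀ x) 1 μ) atTop (𝓝 0) := by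
  have ha₀ : AEStronglyMeasurable a₀ μ := aestronglyMeasurable_of_tendsto_ae atTop ha hlim
  -- Split `a_j b_j - a₀ b₀ = a_j (b_j - b₀) + (a_j - a₀) b₀`. The second term tends to `0` by
  -- dominated convergence with majorant `2K |b₀|`, the first by the uniform bound on `a_j`.
  have h1 : Tendsto (fun j => eLpNorm (fun x => (a j x - a₀ x) * b₀ x) 1 μ) atTop (𝓝 0) := by
    simp_rw [eLpNorm_one_eq_lintegral_enorm]
    have := tendsto_lintegral_of_dominated_convergence' (μ := μ)
      (F := fun j x => ‖(a j x - a₀ x) * b₀ x‖ₑ) (f := fun _ => 0)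
      (fun x => ‖(2 * K) * b₀ x‖ₑ)
      (fun j => (((ha j).sub ha₀).mul hb₀.aestronglyMeasurable).enorm)
      (fun j => Eventually.of_forall fun x => by
        beta_reduce
        rw [enorm_mul, enorm_mul]
        gcongr
        rw [enorm_le_iff_norm_le, Real.norm_eq_abs, Real.norm_eq_abs]
        have h3 := abs_sub (a j x) (a₀ x)
        have h4 := haK j x
        have h5 := haK₀ x
        refine le_trans ?_ (le_abs_self _)
        linarith)
      (hb₀.const_mul (2 * K)).2.ne
      (by
        filter_upwards [hlim] with x hx
        have : Tendsto (fun j => ‖(a j x - a₀ x) * b₀ x‖ₑ) atTop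
            (𝓝 ‖(a₀ x - a₀ x) * b₀ x‖ₑ) :=
          ((hx.sub_const _).mul_const _).enorm
        simpa using this)
    simpa using this
  have h2 : Tendsto (fun j => eLpNorm (fun x => a j x * (b j x - b₀ x)) 1 μ) atTop (𝓝 0) := by
    have h3 : Tendsto (fun j => ENNReal.ofReal K * eLpNorm (fun x => b j x - b₀ x) 1 μ) atTop
        (𝓝 0) := by
      simpa using ENNReal.Tendsto.const_mul hbl (Or.inr ENNReal.ofReal_ne_top)
    refine tendsto_of_tendsto_of_tendsto_of_le_of_le tendsto_const_nhds h3
      (fun _ => zero_le) fun j => ?_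
    refine eLpNorm_le_mul_eLpNorm_of_ae_le_mul (Eventually.of_forall fun x => ?_) 1
    rw [norm_mul]
    gcongr
    exact haK j x
  refine tendsto_of_tendsto_of_tendsto_of_le_of_le tendsto_const_nhds
    (by simpa using h2.add h1) (fun _ => zero_le) fun j => ?_
  have he : (fun x => a j x * b j x - a₀ x * b₀ x) =
      (fun x => a j x * (b j x - b₀ x)) + fun x => (a j x - a₀ x) * b₀ x := by
    ext x; simp only [Pi.add_apply]; ring
  rw [he]
  exact eLpNorm_add_le ((ha j).mul ((hb j).sub hb₀.aestronglyMeasurable))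
    (((ha j).sub ha₀).mul hb₀.aestronglyMeasurable) le_rfl

lemma integrable_mul_of_bound {a b : α → ℝ} {K : ℝ} (ha : AEStronglyMeasurable a μ)
    (haK : ∀ x, |a x| ≤ K) (hb : Integrable b μ) : Integrable (fun x => a x * b x) μ :=
  hb.bdd_mul ha (Eventually.of_forall haK)

lemma tendsto_integral_mul {a : ℕ → α → ℝ} {a₀ : α → ℝ} {b : ℕ → α → ℝ} {b₀ : α → ℝ} {K : ℝ}
    (ha : ∀ j, AEStronglyMeasurable (a j) μ) (haK : ∀ j x, |a j x| ≤ K)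
    (haK₀ : ∀ x, |a₀ x| ≤ K)
    (hlim : ∀ᵐ x ∂μ, Tendsto (fun j => a j x) atTop (𝓝 (a₀ x)))
    (hb : ∀ j, Integrable (b j) μ) (hb₀ : Integrable b₀ μ)
    (hbl : Tendsto (fun j => eLpNorm (fun x => b j x - b₀ x) 1 μ) atTop (𝓝 0)) :
    Tendsto (fun j => ∫ x, a j x * b j x ∂μ) atTop (𝓝 (∫ x, a₀ x * b₀ x ∂μ)) :=
  tendsto_integral_of_L1' _
    (integrable_mul_of_bound (aestronglyMeasurable_of_tendsto_ae atTop ha hlim) haK₀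
      hb₀).aestronglyMeasurable
    (Eventually.of_forall fun j => integrable_mul_of_bound (ha j) (haK j) (hb j))
    (tendsto_eLpNorm_one_mul ha haK haK₀ hlim (fun j => (hb j).aestronglyMeasurable) hb₀ hbl)

end Convergence

/-! ### The chain rule in `W₀^{1,1}` -/

section ChainRule

variable {v : Rn n → ℝ} {g : Fin n → Rn n → ℝ}

lemma MemW11Zero.integrable (h : MemW11Zero Ω v g) : IntegrableOn v Ω :=
  memLp_one_iff_integrable.1 h.memLp

lemma MemW11Zero.integrable_grad (h : MemW11Zero Ω v g) (i : Fin n) : IntegrableOn (g i) Ω :=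
  memLp_one_iff_integrable.1 (h.memLp_grad i)

lemma IsTestFunction.integrableOn {φ : Rn n → ℝ} (h : IsTestFunction Ω φ) : IntegrableOn φ Ω :=
  (h.continuous.integrable_of_hasCompactSupport h.compact).integrableOn

lemma IsTestFunction.integrableOn_pderiv {φ : Rn n → ℝ} (h : IsTestFunction Ω φ) (i : Fin n) :
    IntegrableOn (pderiv i φ) Ω :=
  ((h.continuous_pderiv i).integrable_of_hasCompactSupport
    (h.hasCompactSupport_pderiv i)).integrableOn

/-- Elements of `W₀^{1,1}(Ω)` are limits of test functions in `W^{1,1}(Ω)` and almost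
everywhere. -/
lemma MemW11Zero.exists_approx_ae (h : MemW11Zero Ω v g) :
    ∃ φ : ℕ → Rn n → ℝ, (∀ j, IsTestFunction Ω (φ j)) ∧
      Tendsto (fun j => eLpNorm (fun x => φ j x - v x) 1 (volume.restrict Ω)) atTop (𝓝 0) ∧
      (∀ i, Tendsto (fun j => eLpNorm (fun x => pderiv i (φ j) x - g i x) 1
        (volume.restrict Ω)) atTop (𝓝 0)) ∧
      ∀ᵐ x ∂(volume.restrict Ω), Tendsto (fun j => φ j x) atTop (𝓝 (v x)) := by
  obtain ⟨φ, hφ, hv, hg⟩ := h.approx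
  have hm : TendstoInMeasure (volume.restrict Ω) φ atTop v :=
    tendstoInMeasure_of_tendsto_eLpNorm one_ne_zero
      (fun j => (hφ j).continuous.aestronglyMeasurable) h.memLp.aestronglyMeasurable hv
  obtain ⟨ns, hns, hae⟩ := hm.exists_seq_tendsto_ae
  exact ⟨fun j => φ (ns j), fun j => hφ _, hv.comp hns.tendsto_atTop,
    fun i => (hg i).comp hns.tendsto_atTop, hae⟩

lemma lipschitz_of_hasDerivAt_bound {S S' : ℝ → ℝ} {K : ℝ} (hS : ∀ σ, HasDerivAt S (S' σ) σ)
    (hK : ∀ σ, |S' σ| ≤ K) (a b : ℝ) : |S a - S b| ≤ K * |a - b| :=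
  Convex.norm_image_sub_le_of_norm_hasDerivWithin_le (s := Set.univ)
    (fun x _ => (hS x).hasDerivWithinAt) (fun x _ => hK x) convex_univ trivial trivial

lemma integrableOn_comp {S S' : ℝ → ℝ} {K : ℝ} (hΩ : volume Ω ≠ ⊤)
    (hS : ∀ σ, HasDerivAt S (S' σ) σ) (hK : ∀ σ, |S' σ| ≤ K) (hv : IntegrableOn v Ω) :
    IntegrableOn (fun x => S (v x)) Ω := by
  have hSc : Continuous S := continuous_iff_continuousAt.2 fun σ => (hS σ).continuousAt
  have : IsFiniteMeasure (volume.restrict Ω) := ⟨by simpa using hΩ.lt_top⟩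
  have : Integrable (fun x => |S 0| + K * |v x|) (volume.restrict Ω) :=
    (integrable_const _).add (hv.abs.const_mul K)
  refine this.mono' (hSc.comp_aestronglyMeasurable hv.aestronglyMeasurable)
    (Eventually.of_forall fun x => ?_)
  have h1 := lipschitz_of_hasDerivAt_bound hS hK (v x) 0
  rw [sub_zero] at h1
  have h2 := abs_sub_abs_le_abs_sub (S (v x)) (S 0)
  rw [Real.norm_eq_abs]
  linarith

/-- Chain rule in `W₀^{1,1}(Ω)` for `C¹` functions with bounded derivative. -/
lemma MemW11Zero.hasWeakDeriv_comp (h : MemW11Zero Ω v g) (hΩ : volume Ω ≠ ⊤)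
    {S S' : ℝ → ℝ} {K : ℝ} (hS : ∀ σ, HasDerivAt S (S' σ) σ) (hS' : Continuous S')
    (hK : ∀ σ, |S' σ| ≤ K) (i : Fin n) :
    HasWeakDeriv Ω i (fun x => S (v x)) (fun x => S' (v x) * g i x) := by
  have hI := integrableOn_comp hΩ hS hK h.integrable
  have hI' : IntegrableOn (fun x => S' (v x) * g i x) Ω :=
    integrable_mul_of_bound (hS'.comp_aestronglyMeasurable h.memLp.aestronglyMeasurable)
      (fun x => hK _) (h.integrable_grad i)
  refine ⟨hI.locallyIntegrableOn, hI'.locallyIntegrableOn, fun ψ hψ => ?_⟩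
  -- The identity holds for the smooth approximations and passes to the limit: `S(φ_j) → S(v)` in
  -- `L¹` since `S` is Lipschitz, while `S'(φ_j)` is bounded and converges almost everywhere, which
  -- suffices against the `L¹` convergence of the derivatives.
  obtain ⟨φ, hφ, hv, hg, hae⟩ := h.exists_approx_ae
  obtain ⟨C, hC⟩ := hψ.exists_bound
  obtain ⟨C', hC'⟩ := hψ.exists_bound_pderiv i
  have hK0 : 0 ≤ K := (abs_nonneg _).trans (hK 0)
  have hC0 : 0 ≤ C := (abs_nonneg _).trans (hC 0)
  have h1 : Tendsto (fun j => ∫ x in Ω, pderiv i ψ x * S (φ j x)) atTop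
      (𝓝 (∫ x in Ω, pderiv i ψ x * S (v x))) := by
    refine tendsto_integral_mul (a := fun _ => pderiv i ψ)
      (fun _ => (hψ.continuous_pderiv i).aestronglyMeasurable) (fun _ => hC') hC'
      (Eventually.of_forall fun _ => tendsto_const_nhds)
      (fun j => integrableOn_comp hΩ hS hK (hφ j).integrableOn) hI ?_
    have h3 : Tendsto (fun j => ENNReal.ofReal K *
        eLpNorm (fun x => φ j x - v x) 1 (volume.restrict Ω)) atTop (𝓝 0) := by
      simpa using ENNReal.Tendsto.const_mul hv (Or.inr ENNReal.ofReal_ne_top)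
    refine tendsto_of_tendsto_of_tendsto_of_le_of_le tendsto_const_nhds h3
      (fun _ => zero_le) fun j => ?_
    exact eLpNorm_le_mul_eLpNorm_of_ae_le_mul
      (Eventually.of_forall fun x => lipschitz_of_hasDerivAt_bound hS hK _ _) 1
  have h2 : Tendsto (fun j => ∫ x in Ω, (S' (φ j x) * ψ x) * pderiv i (φ j) x) atTop
      (𝓝 (∫ x in Ω, (S' (v x) * ψ x) * g i x)) := by
    have hb : ∀ σ x, |S' σ * ψ x| ≤ K * C := fun σ x => by
      rw [abs_mul]; exact mul_le_mul (hK _) (hC _) (abs_nonneg _) hK0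
    refine tendsto_integral_mul (a := fun j x => S' (φ j x) * ψ x) (K := K * C)
      (fun j => ((hS'.comp (hφ j).continuous).mul hψ.continuous).aestronglyMeasurable)
      (fun j x => hb _ _) (fun x => hb _ _) ?_ (fun j => (hφ j).integrableOn_pderiv i)
      (h.integrable_grad i) (hg i)
    filter_upwards [hae] with x hx
    exact ((hS'.tendsto _).comp hx).mul_const _
  have h3 : ∀ j, ∫ x in Ω, pderiv i ψ x * S (φ j x) =
      - ∫ x in Ω, (S' (φ j x) * ψ x) * pderiv i (φ j) x := fun j => by
    have := integral_comp_mul_pderiv hS hS' (hφ j) hψ i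
    simp_rw [mul_comm (pderiv i ψ _), this, mul_right_comm]
  have h4 := tendsto_nhds_unique (h1.congr h3) h2.neg
  simp_rw [mul_comm (S (v _)), h4, mul_right_comm]

/-- Weak derivatives are unique almost everywhere. -/
lemma HasWeakDeriv.ae_eq {w w' : Rn n → ℝ} {i : Fin n} (hΩ : IsOpen Ω)
    (h : HasWeakDeriv Ω i v w) (h' : HasWeakDeriv Ω i v w') :
    w =ᵐ[volume.restrict Ω] w' := by
  have hi : ∀ {w : Rn n → ℝ}, LocallyIntegrableOn w Ω volume → ∀ φ : Rn n → ℝ,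
      IsTestFunction Ω φ → Integrable (fun x => φ x * w x) := fun {w} hw φ hφ => by
    have hK : IntegrableOn w (tsupport φ) volume :=
      hw.integrableOn_compact_subset hφ.support hφ.compact
    obtain ⟨C, hC⟩ := hφ.exists_bound
    have := integrable_mul_of_bound (hφ.continuous.aestronglyMeasurable
      (μ := volume.restrict (tsupport φ))) hC hK
    refine (integrableOn_iff_integrable_of_support_subset (s := tsupport φ) ?_).1 this
    exact (Function.support_mul_subset_left _ _).trans (subset_tsupport φ)
  have h0 := hΩ.ae_eq_zero_of_integral_contDiff_smul_eq_zero
    (h.locallyIntegrable_deriv.sub h'.locallyIntegrable_deriv) fun φ h1 h2 h3 => by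
      have hφ : IsTestFunction Ω φ := ⟨h1, h2, h3⟩
      have he := (h.integral_eq φ hφ).symm.trans (h'.integral_eq φ hφ)
      rw [neg_inj] at he
      rw [setIntegral_eq_integral_of_forall_compl_eq_zero
          fun x hx => by rw [hφ.eq_zero_of_notMem hx, mul_zero],
        setIntegral_eq_integral_of_forall_compl_eq_zero
          fun x hx => by rw [hφ.eq_zero_of_notMem hx, mul_zero]] at he
      simp_rw [mul_comm _ (φ _)] at he
      simp only [Pi.sub_apply, smul_eq_mul, mul_sub]
      rw [integral_sub (hi h.locallyIntegrable_deriv φ hφ)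
        (hi h'.locallyIntegrable_deriv φ hφ), he, sub_self]
  rw [EventuallyEq, ae_restrict_iff' hΩ.measurableSet]
  filter_upwards [h0] with x hx hxΩ
  exact sub_eq_zero.1 (hx hxΩ)

end ChainRule

/-! ### Truncations -/

section Truncation

lemma trunc_of_abs_le {k σ : ℝ} (h : |σ| ≤ k) : trunc k σ = σ := by
  obtain ⟨h1, h2⟩ := abs_le.1 h
  rw [trunc, abs_of_nonneg (by linarith), abs_of_nonneg (by linarith)]; ring

lemma trunc_of_le {k σ : ℝ} (hk : 0 ≤ k) (h : k ≤ σ) : trunc k σ = k := by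
  rw [trunc, abs_of_nonneg (by linarith), abs_of_nonpos (by linarith)]; ring

lemma trunc_of_le_neg {k σ : ℝ} (hk : 0 ≤ k) (h : σ ≤ -k) : trunc k σ = -k := by
  rw [trunc, abs_of_nonpos (by linarith), abs_of_nonneg (by linarith)]; ring

lemma abs_trunc {k : ℝ} (hk : 0 ≤ k) (σ : ℝ) : |trunc k σ| = min |σ| k := by
  rcases le_total |σ| k with h | h
  · rw [trunc_of_abs_le h, min_eq_left h]
  · rw [min_eq_right h]
    rcases le_abs.1 h with h | h
    · rw [trunc_of_le hk h, abs_of_nonneg hk]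
    · rw [trunc_of_le_neg hk (by linarith), abs_neg, abs_of_nonneg hk]

lemma continuous_trunc (k : ℝ) : Continuous (trunc k) := by
  unfold trunc; fun_prop

lemma trunc_trunc {j k : ℝ} (hj : 0 ≤ j) (hjk : j ≤ k) (σ : ℝ) :
    trunc j (trunc k σ) = trunc j σ := by
  have hk := hj.trans hjk
  rcases le_total |σ| k with h | h
  · rw [trunc_of_abs_le h]
  · rcases le_abs.1 h with h | h
    · rw [trunc_of_le hk h, trunc_of_le hj hjk, trunc_of_le hj (hjk.trans h)]
    · rw [trunc_of_le_neg hk (by linarith), trunc_of_le_neg hj (by linarith),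
        trunc_of_le_neg hj (by linarith)]

lemma abs_trunc_lt_iff {j k : ℝ} (hj : 0 ≤ j) (hjk : j ≤ k) (σ : ℝ) :
    |trunc k σ| < j ↔ |σ| < j := by
  rw [abs_trunc (hj.trans hjk), min_lt_iff]
  exact ⟨fun h => h.resolve_right (not_lt.2 hjk), Or.inl⟩

lemma hasDerivAt_trunc {k σ : ℝ} (hk : 0 ≤ k) (h : σ ≠ k) (h' : σ ≠ -k) :
    HasDerivAt (trunc k) ({σ | |σ| < k}.indicator (fun _ => (1 : ℝ)) σ) σ := by
  rcases lt_or_ge |σ| k with h1 | h1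
  · rw [Set.indicator_of_mem (by exact h1)]
    refine (hasDerivAt_id σ).congr_of_eventuallyEq ?_
    filter_upwards [(continuous_abs.tendsto σ).eventually (gt_mem_nhds h1)] with τ hτ
    exact trunc_of_abs_le hτ.le
  · rw [Set.indicator_of_notMem (by simpa using h1)]
    rcases le_abs.1 h1 with h2 | h2
    · refine (hasDerivAt_const σ k).congr_of_eventuallyEq ?_
      filter_upwards [lt_mem_nhds (lt_of_le_of_ne h2 h.symm)] with τ hτ
      exact trunc_of_le hk hτ.le
    · refine (hasDerivAt_const σ (-k)).congr_of_eventuallyEq ?_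
      filter_upwards [gt_mem_nhds (lt_of_le_of_ne (by linarith : σ ≤ -k) h')] with τ hτ
      exact trunc_of_le_neg hk hτ.le

/-- Since `T_k` is a primitive of the indicator of `(-k, k)`, primitives of continuous
approximations of that indicator are `C¹` approximations of `T_k`, to which the smooth chain rule
applies. -/
lemma integral_indicator_eq_trunc {k : ℝ} (hk : 0 ≤ k) (σ : ℝ) :
    ∫ s in (0 : ℝ)..σ, {s | |s| < k}.indicator (fun _ => (1 : ℝ)) s = trunc k σ := by
  have hm : MeasurableSet {s : ℝ | |s| < k} := measurableSet_lt measurable_norm measurable_const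
  rw [integral_eq_of_hasDerivAt_off_countable (trunc k) _ (s := {k, -k})
    ((Set.toFinite _).countable) (continuous_trunc k).continuousOn]
  · rw [trunc_of_abs_le (σ := 0) (by simpa using hk), sub_zero]
  · rintro x ⟨-, hx⟩
    simp only [Set.mem_insert_iff, Set.mem_singleton_iff, not_or] at hx
    exact hasDerivAt_trunc hk hx.1 hx.2
  · rw [intervalIntegrable_iff]
    exact (integrableOn_const (by simp)).indicator hm

/-- Continuous approximations of the indicator of `(-k, k)`. -/
def cutoff (k : ℝ) (m : ℕ) (σ : ℝ) : ℝ := max 0 (min 1 (m * (k - |σ|)))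

lemma continuous_cutoff (k : ℝ) (m : ℕ) : Continuous (cutoff k m) := by
  unfold cutoff; fun_prop

lemma abs_cutoff_le_one (k : ℝ) (m : ℕ) (σ : ℝ) : |cutoff k m σ| ≤ 1 := by
  rw [cutoff, abs_of_nonneg (le_max_left _ _)]
  exact max_le zero_le_one (min_le_left _ _)

/-- At `|σ| = k` both sides vanish, so the convergence holds at every point. The chain rule for
truncations thus does not need the fact that `∇v = 0` almost everywhere on `{|v| = k}`. -/
lemma tendsto_cutoff (k σ : ℝ) : Tendsto (fun m => cutoff k m σ) atTop
    (𝓝 ({s | |s| < k}.indicator (fun _ => (1 : ℝ)) σ)) := by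
  rcases lt_or_ge |σ| k with h | h
  · rw [Set.indicator_of_mem (by exact h)]
    have h1 : Tendsto (fun m : ℕ => (m : ℝ) * (k - |σ|)) atTop atTop :=
      tendsto_natCast_atTop_atTop.atTop_mul_const (sub_pos.2 h)
    refine tendsto_const_nhds.congr' ?_
    filter_upwards [h1.eventually_ge_atTop 1] with m hm
    rw [cutoff, min_eq_left hm, max_eq_right zero_le_one]
  · rw [Set.indicator_of_notMem (by simpa using h)]
    refine tendsto_const_nhds.congr fun m => ?_
    rw [cutoff, max_eq_left]
    exact (min_le_right _ _).trans (mul_nonpos_of_nonneg_of_nonpos (by positivity) (by linarith))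

variable {v : Rn n → ℝ} {g : Fin n → Rn n → ℝ}

/-- Chain rule in `W₀^{1,1}(Ω)` for truncations. -/
lemma MemW11Zero.hasWeakDeriv_trunc (h : MemW11Zero Ω v g) (hΩ : volume Ω ≠ ⊤) {k : ℝ}
    (hk : 0 ≤ k) (i : Fin n) :
    HasWeakDeriv Ω i (fun x => trunc k (v x)) ({x | |v x| < k}.indicator (g i)) := by
  have hv := h.memLp.aestronglyMeasurable
  have hind : ∀ x, {x | |v x| < k}.indicator (g i) x =
      {s | |s| < k}.indicator (fun _ => (1 : ℝ)) (v x) * g i x := fun x => by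
    by_cases hx : |v x| < k
    · rw [Set.indicator_of_mem (by exact hx), Set.indicator_of_mem (by exact hx), one_mul]
    · rw [Set.indicator_of_notMem (by exact hx), Set.indicator_of_notMem (by exact hx), zero_mul]
  have hm : MeasurableSet {s : ℝ | |s| < k} := measurableSet_lt measurable_norm measurable_const
  have hb1 : ∀ s : ℝ, |{s | |s| < k}.indicator (fun _ => (1 : ℝ)) s| ≤ 1 := fun s => by
    by_cases hs : |s| < k
    · rw [Set.indicator_of_mem (by exact hs), abs_one]
    · rw [Set.indicator_of_notMem (by exact hs), abs_zero]; exact zero_le_one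
  have : IsFiniteMeasure (volume.restrict Ω) := ⟨by simpa using hΩ.lt_top⟩
  have hI : IntegrableOn (fun x => trunc k (v x)) Ω :=
    Integrable.mono' (integrable_const k) ((continuous_trunc k).comp_aestronglyMeasurable hv)
      (Eventually.of_forall fun x => by
        rw [Real.norm_eq_abs, abs_trunc hk]; exact min_le_right _ _)
  have hI' : IntegrableOn ({x | |v x| < k}.indicator (g i)) Ω := by
    rw [show {x | |v x| < k}.indicator (g i) = _ from funext hind]
    exact integrable_mul_of_bound ((measurable_const.indicator hm).comp_aemeasurable
      hv.aemeasurable).aestronglyMeasurable (fun x => hb1 _) (h.integrable_grad i)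
  refine ⟨hI.locallyIntegrableOn, hI'.locallyIntegrableOn, fun ψ hψ => ?_⟩
  let S : ℕ → ℝ → ℝ := fun m σ => ∫ s in (0 : ℝ)..σ, cutoff k m s
  have hS : ∀ m σ, HasDerivAt (S m) (cutoff k m σ) σ := fun m σ =>
    (continuous_cutoff k m).integral_hasStrictDerivAt 0 σ |>.hasDerivAt
  have hSlim : ∀ σ, Tendsto (fun m => S m σ) atTop (𝓝 (trunc k σ)) := fun σ => by
    rw [← integral_indicator_eq_trunc hk σ]
    refine intervalIntegral.tendsto_integral_filter_of_dominated_convergence (fun _ => 1)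
      (Eventually.of_forall fun m => (continuous_cutoff k m).aestronglyMeasurable)
      (Eventually.of_forall fun m => Eventually.of_forall fun x _ => abs_cutoff_le_one k m x)
      (by simp) (Eventually.of_forall fun x _ => tendsto_cutoff k x)
  obtain ⟨C, hC⟩ := hψ.exists_bound
  obtain ⟨C', hC'⟩ := hψ.exists_bound_pderiv i
  have hSb : ∀ m σ, |S m σ| ≤ |σ| := fun m σ => by
    have := lipschitz_of_hasDerivAt_bound (hS m) (abs_cutoff_le_one k m) σ 0
    simpa [S] using this
  have h1 : Tendsto (fun m => ∫ x in Ω, S m (v x) * pderiv i ψ x) atTop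
      (𝓝 (∫ x in Ω, trunc k (v x) * pderiv i ψ x)) := by
    refine tendsto_integral_of_dominated_convergence (fun x => |v x| * C') (fun m => ?_)
      (h.integrable.abs.mul_const C')
      (fun m => Eventually.of_forall fun x => ?_)
      (Eventually.of_forall fun x => (hSlim _).mul_const _)
    · exact ((continuous_iff_continuousAt.2 fun σ =>
        (hS m σ).continuousAt).comp_aestronglyMeasurable hv).mul
          (hψ.continuous_pderiv i).aestronglyMeasurable
    · rw [norm_mul]
      exact mul_le_mul (hSb _ _) (hC' x) (norm_nonneg _) (abs_nonneg _)
  have h2 : Tendsto (fun m => ∫ x in Ω, cutoff k m (v x) * g i x * ψ x) atTop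
      (𝓝 (∫ x in Ω, {x | |v x| < k}.indicator (g i) x * ψ x)) := by
    refine tendsto_integral_of_dominated_convergence (fun x => |g i x| * C) (fun m => ?_)
      ((h.integrable_grad i).abs.mul_const C)
      (fun m => Eventually.of_forall fun x => ?_)
      (Eventually.of_forall fun x => ?_)
    · exact (((continuous_cutoff k m).comp_aestronglyMeasurable hv).mul
        (h.integrable_grad i).aestronglyMeasurable).mul hψ.continuous.aestronglyMeasurable
    · rw [norm_mul, norm_mul]
      refine mul_le_mul ?_ (hC x) (norm_nonneg _) (abs_nonneg _)
      exact mul_le_of_le_one_left (abs_nonneg _) (abs_cutoff_le_one k m _)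
    · rw [hind]
      exact ((tendsto_cutoff k _).mul_const _).mul_const _
  refine tendsto_nhds_unique (h1.congr fun m => ?_) h2.neg
  exact (h.hasWeakDeriv_comp hΩ (hS m) (continuous_cutoff k m)
    (abs_cutoff_le_one k m) i).integral_eq ψ hψ

end Truncation

/-! ### Existence of the generalized gradient -/

section GenGrad

lemma HasWeakDeriv.congr {i : Fin n} {v w w' : Rn n → ℝ}
    (h : HasWeakDeriv Ω i v w) (hw : w =ᵐ[volume.restrict Ω] w') : HasWeakDeriv Ω i v w' where
  locallyIntegrable := h.locallyIntegrable
  locallyIntegrable_deriv := by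
    intro x hx
    obtain ⟨s, hs, hi⟩ := h.locallyIntegrable_deriv x hx
    -- The neighbourhood is cut down to `Ω`, because the two derivatives are compared only there.
    refine ⟨s ∩ Ω, inter_mem hs self_mem_nhdsWithin, ?_⟩
    exact (hi.mono_set Set.inter_subset_left).congr_fun_ae
      (ae_restrict_of_ae_restrict_of_subset Set.inter_subset_right hw)
  integral_eq φ hφ := by
    rw [h.integral_eq φ hφ]
    congr 1
    refine integral_congr_ae ?_
    filter_upwards [hw] with x hx
    rw [hx]

/-- Because `T_j ∘ T_k = T_j` for `j ≤ k`, the chain rule and uniqueness of weak derivatives show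
that the gradient of `T_j(u)` is that of `T_k(u)` restricted to `{|u| < j}`. The gradients are glued
by using, at each point, some integer level above `|u|`. -/
theorem MemTSpace.exists_hasGenGrad {p : Fin n → ℝ} {u : Rn n → ℝ} (hΩ : IsOpen Ω)
    (hΩf : volume Ω ≠ ⊤) (hu : MemTSpace Ω p u) : ∃ G, HasGenGrad Ω u G := by
  obtain ⟨C, hC⟩ := hu.trunc_mem
  choose! g hg _ using hC
  have key : ∀ i j k : _, 0 < j → j ≤ k →
      g j i =ᵐ[volume.restrict Ω] {x | |u x| < j}.indicator (g k i) := fun i j k hj hjk => by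
    have h1 := (hg k (hj.trans_le hjk)).memW11Zero.hasWeakDeriv_trunc hΩf hj.le i
    simp_rw [trunc_trunc hj.le hjk, abs_trunc_lt_iff hj.le hjk] at h1
    exact ((hg j hj).memW11Zero.hasWeakDeriv i).ae_eq hΩ h1
  let N : Rn n → ℕ := fun x => ⌊|u x|⌋₊ + 1
  refine ⟨fun i x => g (N x) i x, fun i => ?_⟩
  have hae : ∀ k : ℝ, 0 < k →
      g k i =ᵐ[volume.restrict Ω] {x | |u x| < k}.indicator (fun x => g (N x) i x) := by
    intro k hk
    -- The levels `k` and `m + 1` are compared through the smaller level `min k (m + 1)`. Only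
    -- countably many `m` occur, so one null set serves for all of them, and `m` may then depend on
    -- the point.
    have h2 : ∀ᵐ x ∂(volume.restrict Ω), ∀ m : ℕ,
        g (min k (m + 1)) i x =
          {x | |u x| < min k (m + 1)}.indicator (g ((m + 1 : ℕ) : ℝ) i) x ∧
        g (min k (m + 1)) i x = {x | |u x| < min k (m + 1)}.indicator (g k i) x := by
      refine ae_all_iff.2 fun m => ?_
      have hpos : 0 < min k ((m : ℝ) + 1) := lt_min hk (by positivity)
      filter_upwards [key i _ _ hpos (min_le_left _ _),
        key i _ ((m + 1 : ℕ) : ℝ) hpos (by push_cast; exact min_le_right _ _)] with x h3 h4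
      exact ⟨h4, h3⟩
    -- Comparison with the level `k + 1` shows that `g k` vanishes where `|u| ≥ k`.
    filter_upwards [h2, key i k (k + 1) hk (by linarith)] with x hx hx'
    by_cases hux : |u x| < k
    · rw [Set.indicator_of_mem (by exact hux)]
      obtain ⟨h3, h4⟩ := hx ⌊|u x|⌋₊
      have h5 : |u x| < min k ((⌊|u x|⌋₊ : ℝ) + 1) := lt_min hux (Nat.lt_floor_add_one _)
      rw [h3, Set.indicator_of_mem (by exact h5), Set.indicator_of_mem (by exact h5)] at h4
      exact h4.symm
    · rw [hx', Set.indicator_of_notMem (by exact hux), Set.indicator_of_notMem (by exact hux)]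
  constructor
  · have hlim : ∀ᵐ x ∂(volume.restrict Ω), Tendsto (fun m : ℕ => g ((m + 1 : ℕ) : ℝ) i x) atTop
        (𝓝 (g (N x) i x)) := by
      have : ∀ᵐ x ∂(volume.restrict Ω), ∀ m : ℕ, g ((m + 1 : ℕ) : ℝ) i x =
          {x | |u x| < ((m + 1 : ℕ) : ℝ)}.indicator (fun x => g (N x) i x) x :=
        ae_all_iff.2 fun m => hae _ (by positivity)
      filter_upwards [this] with x hx
      refine tendsto_const_nhds.congr' ?_
      filter_upwards [eventually_ge_atTop ⌊|u x|⌋₊] with m hm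
      rw [hx m, Set.indicator_of_mem]
      have h6 := Nat.lt_floor_add_one |u x|
      have h7 : (⌊|u x|⌋₊ : ℝ) ≤ m := by exact_mod_cast hm
      simp only [Set.mem_ofPred_eq]
      push_cast
      linarith
    exact aemeasurable_of_tendsto_metrizable_ae' (fun m =>
      ((hg _ (by positivity)).memW11Zero.memLp_grad i).aestronglyMeasurable.aemeasurable) hlim
  · intro k hk
    exact ((hg k hk).memW11Zero.hasWeakDeriv i).congr (hae k hk)

theorem MemTSpace.hasGenGrad_genGrad {p : Fin n → ℝ} {u : Rn n → ℝ} (hΩ : IsOpen Ω)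
    (hΩf : volume Ω ≠ ⊤) (hu : MemTSpace Ω p u) : HasGenGrad Ω u (genGrad Ω u) := by
  have h := hu.exists_hasGenGrad hΩ hΩf
  rw [genGrad, dif_pos h]
  exact h.choose_spec

end GenGrad

/-! ### The anisotropic Sobolev inequality -/

/-- The grid-lines lemma for `n` different functions. -/
lemma lintegral_prod_lintegral_pow_le_mul (hn : 2 ≤ n) {F : Fin n → (Fin n → ℝ) → ℝ≥0∞}
    (hF : ∀ i, Measurable (F i)) {a : Fin n → ℝ≥0∞} (ha0 : ∀ i, a i ≠ 0) (hat : ∀ i, a i ≠ ⊤)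
    (hFa : ∀ i, ∫⁻ x, F i x ≤ a i) :
    ∫⁻ x, ∏ i, (∫⁻ t, F i (Function.update x i t)) ^ (1 / ((n : ℝ) - 1)) ≤
      (n : ℝ≥0∞) ^ ((n : ℝ) / (n - 1)) * ∏ i, a i ^ (1 / ((n : ℝ) - 1)) := by
  have hn' : (2 : ℝ) ≤ n := by exact_mod_cast hn
  have hr : 0 ≤ 1 / ((n : ℝ) - 1) := by apply div_nonneg <;> linarith
  -- The normalized sum `f = ∑ F i / a i` has integral at most `n` and dominates every `F i / a i`,
  -- which reduces the claim to the grid-lines lemma for the single function `f`.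
  let f : (Fin n → ℝ) → ℝ≥0∞ := fun x => ∑ i, (a i)⁻¹ * F i x
  have hf : Measurable f := Finset.measurable_fun_sum _ fun i _ => (hF i).const_mul _
  have hfi : ∫⁻ x, f x ≤ n := by
    calc ∫⁻ x, f x = ∑ i, (a i)⁻¹ * ∫⁻ x, F i x := by
          simp only [f]
          rw [lintegral_finsetSum _ fun i _ => (hF i).const_mul _]
          exact Finset.sum_congr rfl fun i _ => lintegral_const_mul _ (hF i)
      _ ≤ ∑ i : Fin n, 1 := by
          gcongr with i
          calc (a i)⁻¹ * ∫⁻ x, F i x ≤ (a i)⁻¹ * a i := by gcongr; exact hFa i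
            _ = 1 := ENNReal.inv_mul_cancel (ha0 i) (hat i)
      _ = n := by simp
  have hle : ∀ i x, F i x ≤ a i * f x := fun i x => by
    calc F i x = a i * ((a i)⁻¹ * F i x) := by
          rw [← mul_assoc, ENNReal.mul_inv_cancel (ha0 i) (hat i), one_mul]
      _ ≤ a i * f x := by
          gcongr
          exact Finset.single_le_sum (f := fun i => (a i)⁻¹ * F i x)
            (fun _ _ => zero_le) (Finset.mem_univ i)
  have hconj : Real.HolderConjugate (Fintype.card (Fin n)) ((n : ℝ) / (n - 1)) := by
    rw [Fintype.card_fin]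
    exact Real.HolderConjugate.conjExponent (by linarith)
  have hgrid := lintegral_prod_lintegral_pow_le (fun _ : Fin n => (volume : Measure ℝ)) hconj hf
  rw [Fintype.card_fin] at hgrid
  calc ∫⁻ x, ∏ i, (∫⁻ t, F i (Function.update x i t)) ^ (1 / ((n : ℝ) - 1))
      ≤ ∫⁻ x, (∏ i, a i ^ (1 / ((n : ℝ) - 1))) *
          ∏ i, (∫⁻ t, f (Function.update x i t)) ^ (1 / ((n : ℝ) - 1)) := by
        gcongr with x
        rw [← Finset.prod_mul_distrib]
        gcongr with i
        rw [← ENNReal.mul_rpow_of_nonneg _ _ hr]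
        gcongr
        rw [← lintegral_const_mul' _ _ (hat i)]
        exact lintegral_mono fun t => hle i _
    _ = (∏ i, a i ^ (1 / ((n : ℝ) - 1))) *
          ∫⁻ x, ∏ i, (∫⁻ t, f (Function.update x i t)) ^ (1 / ((n : ℝ) - 1)) :=
        lintegral_const_mul' _ _
          (ENNReal.prod_ne_top fun i _ => ENNReal.rpow_ne_top_of_nonneg hr (hat i))
    _ ≤ (∏ i, a i ^ (1 / ((n : ℝ) - 1))) * (n : ℝ≥0∞) ^ ((n : ℝ) / (n - 1)) := by
        gcongr
        refine hgrid.trans ?_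
        exact ENNReal.rpow_le_rpow hfi (by apply div_nonneg <;> linarith)
    _ = _ := mul_comm _ _

lemma hasDerivAt_toLp_update (x : Fin n → ℝ) (i : Fin n) (t : ℝ) :
    HasDerivAt (fun t => (WithLp.toLp 2 (Function.update x i t) : Rn n))
      (EuclideanSpace.single i 1) t := by
  have h1 := hasDerivAt_update x i t
  exact ((PiLp.continuousLinearEquiv 2 ℝ (fun _ : Fin n => ℝ)).symm.hasFDerivAt.comp_hasDerivAt t h1)

/-- A function of a test function is bounded by the integral of its partial derivative along the
line in the corresponding direction. -/
lemma IsTestFunction.enorm_comp_le_lintegral {φ : Rn n → ℝ} (hφ : IsTestFunction Ω φ)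
    {S S' : ℝ → ℝ} (hS : ∀ σ, HasDerivAt S (S' σ) σ) (hS' : Continuous S') (hS0 : S 0 = 0)
    (i : Fin n) (x : Fin n → ℝ) :
    ‖S (φ (WithLp.toLp 2 x))‖ₑ ≤ ∫⁻ t, ‖S' (φ (WithLp.toLp 2 (Function.update x i t))) *
      pderiv i φ (WithLp.toLp 2 (Function.update x i t))‖ₑ := by
  let h : ℝ → ℝ := fun t => S (φ (WithLp.toLp 2 (Function.update x i t)))
  have hd : ∀ t, HasDerivAt h (S' (φ (WithLp.toLp 2 (Function.update x i t))) *
      pderiv i φ (WithLp.toLp 2 (Function.update x i t))) t := fun t =>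
    (hS _).comp t ((hφ.contDiff_one.differentiable one_ne_zero
      _).hasFDerivAt.comp_hasDerivAt t (hasDerivAt_toLp_update x i t))
  have hc : Continuous fun t => (WithLp.toLp 2 (Function.update x i t) : Rn n) :=
    continuous_iff_continuousAt.2 fun t => (hasDerivAt_toLp_update x i t).continuousAt
  have hdc : ContDiff ℝ 1 h := by
    rw [contDiff_one_iff_deriv]
    refine ⟨fun t => (hd t).differentiableAt, ?_⟩
    rw [show deriv h = _ from funext fun t => (hd t).deriv]
    exact (hS'.comp (hφ.continuous.comp hc)).mul ((hφ.continuous_pderiv i).comp hc)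
  -- Here `S 0 = 0` is essential: composition with `S` must not destroy the compact support.
  have hcs : HasCompactSupport h := by
    have h1 : HasCompactSupport fun y : Fin n → ℝ => S (φ (WithLp.toLp 2 y)) :=
      (hφ.compact.comp_left hS0).comp_homeomorph
        (PiLp.continuousLinearEquiv 2 ℝ (fun _ : Fin n => ℝ)).symm.toHomeomorph
    exact h1.comp_isClosedEmbedding (isClosedEmbedding_update x i)
  calc ‖S (φ (WithLp.toLp 2 x))‖ₑ = ‖h (x i)‖ₑ := by simp [h]
    _ ≤ ∫⁻ t in Set.Iic (x i), ‖deriv h t‖ₑ := hcs.enorm_le_lintegral_Ici_deriv hdc (x i)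
    _ ≤ ∫⁻ t, ‖deriv h t‖ₑ := setLIntegral_le_lintegral _ _
    _ = _ := lintegral_congr fun t => by rw [(hd t).deriv]

/-- Gagliardo's argument: bound the `i`-th factor by an integral along the line in direction `i`,
multiply the `n` bounds, and integrate with the grid-lines lemma. A separate `S i` for each
direction leaves room for powers adapted to `p i`. -/
lemma IsTestFunction.lintegral_prod_le {φ : Rn n → ℝ} (hφ : IsTestFunction Ω φ) (hn : 2 ≤ n)
    (hΩ : MeasurableSet Ω)
    {S S' : Fin n → ℝ → ℝ} (hS : ∀ i σ, HasDerivAt (S i) (S' i σ) σ)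
    (hS' : ∀ i, Continuous (S' i)) (hS0 : ∀ i, S i 0 = 0)
    {a : Fin n → ℝ≥0∞} (ha0 : ∀ i, a i ≠ 0) (hat : ∀ i, a i ≠ ⊤)
    (ha : ∀ i, ∫⁻ x in Ω, ‖S' i (φ x) * pderiv i φ x‖ₑ ≤ a i) :
    ∫⁻ x in Ω, ∏ i, ‖S i (φ x)‖ₑ ^ (1 / ((n : ℝ) - 1)) ≤
      (n : ℝ≥0∞) ^ ((n : ℝ) / (n - 1)) * ∏ i, a i ^ (1 / ((n : ℝ) - 1)) := by
  have hn' : (2 : ℝ) ≤ n := by exact_mod_cast hn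
  have hr : 0 ≤ 1 / ((n : ℝ) - 1) := by apply div_nonneg <;> linarith
  have hmp := PiLp.volume_preserving_toLp (Fin n)
  have hSc : ∀ i, Continuous (S i) := fun i =>
    continuous_iff_continuousAt.2 fun σ => (hS i σ).continuousAt
  have hm : Measurable fun x => ∏ i, ‖S i (φ x)‖ₑ ^ (1 / ((n : ℝ) - 1)) :=
    Finset.measurable_prod _ fun i _ =>
      (((hSc i).comp hφ.continuous).measurable.enorm).pow_const _
  have hF : ∀ i, Measurable fun x => ‖S' i (φ x) * pderiv i φ x‖ₑ := fun i =>
    (((hS' i).comp hφ.continuous).mul (hφ.continuous_pderiv i)).measurable.enorm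
  calc ∫⁻ x in Ω, ∏ i, ‖S i (φ x)‖ₑ ^ (1 / ((n : ℝ) - 1))
      ≤ ∫⁻ x, ∏ i, ‖S i (φ x)‖ₑ ^ (1 / ((n : ℝ) - 1)) := setLIntegral_le_lintegral _ _
    _ = ∫⁻ y : Fin n → ℝ, ∏ i, ‖S i (φ (WithLp.toLp 2 y))‖ₑ ^ (1 / ((n : ℝ) - 1)) :=
        (hmp.lintegral_comp hm).symm
    _ ≤ ∫⁻ y : Fin n → ℝ, ∏ i, (∫⁻ t, ‖S' i (φ (WithLp.toLp 2 (Function.update y i t))) *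
          pderiv i φ (WithLp.toLp 2 (Function.update y i t))‖ₑ) ^ (1 / ((n : ℝ) - 1)) := by
        gcongr with y i
        exact hφ.enorm_comp_le_lintegral (hS i) (hS' i) (hS0 i) i y
    _ ≤ _ := by
        refine lintegral_prod_lintegral_pow_le_mul hn
          (F := fun i y => ‖S' i (φ (WithLp.toLp 2 y)) * pderiv i φ (WithLp.toLp 2 y)‖ₑ)
          (fun i => (hF i).comp hmp.measurable) ha0 hat fun i => ?_
        rw [hmp.lintegral_comp (hF i)]
        refine le_trans (le_of_eq ?_) (ha i)
        rw [← lintegral_indicator hΩ]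
        refine lintegral_congr fun x => ?_
        by_cases hx : x ∈ Ω
        · rw [Set.indicator_of_mem hx]
        · rw [Set.indicator_of_notMem hx, hφ.pderiv_eq_zero_of_notMem i hx]
          simp

/-- The Gagliardo inequality for `n` different functions of an element of `W₀^{1,1}(Ω)`. -/
theorem MemW11Zero.lintegral_prod_le {v : Rn n → ℝ} {g : Fin n → Rn n → ℝ}
    (h : MemW11Zero Ω v g) (hn : 2 ≤ n) (hΩ : MeasurableSet Ω)
    {S S' : Fin n → ℝ → ℝ} {K : ℝ} (hS : ∀ i σ, HasDerivAt (S i) (S' i σ) σ)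
    (hS' : ∀ i, Continuous (S' i)) (hK : ∀ i σ, |S' i σ| ≤ K) (hS0 : ∀ i, S i 0 = 0)
    {a : Fin n → ℝ≥0∞} (hat : ∀ i, a i ≠ ⊤)
    (ha : ∀ i, ∫⁻ x in Ω, ‖S' i (v x) * g i x‖ₑ < a i) :
    ∫⁻ x in Ω, ∏ i, ‖S i (v x)‖ₑ ^ (1 / ((n : ℝ) - 1)) ≤
      (n : ℝ≥0∞) ^ ((n : ℝ) / (n - 1)) * ∏ i, a i ^ (1 / ((n : ℝ) - 1)) := by
  have hn' : (2 : ℝ) ≤ n := by exact_mod_cast hn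
  have hr : 0 ≤ 1 / ((n : ℝ) - 1) := by apply div_nonneg <;> linarith
  obtain ⟨φ, hφ, hv, hg, hae⟩ := h.exists_approx_ae
  have hSc : ∀ i, Continuous (S i) := fun i =>
    continuous_iff_continuousAt.2 fun σ => (hS i σ).continuousAt
  -- The strict inequality for the limit `v` gives the bound by the same `a i` for all but finitely
  -- many approximations.
  have hev : ∀ i, ∀ᶠ j in atTop, ∫⁻ x in Ω, ‖S' i (φ j x) * pderiv i (φ j) x‖ₑ ≤ a i := by
    intro i
    have h1 := tendsto_eLpNorm_one_mul (μ := volume.restrict Ω) (a := fun j x => S' i (φ j x))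
      (a₀ := fun x => S' i (v x)) (K := K)
      (fun j => ((hS' i).comp (hφ j).continuous).aestronglyMeasurable) (fun j x => hK i _)
      (fun x => hK i _) (by
        filter_upwards [hae] with x hx
        exact ((hS' i).tendsto _).comp hx)
      (fun j => ((hφ j).continuous_pderiv i).aestronglyMeasurable) (h.integrable_grad i) (hg i)
    have h2 := h1.add_const (eLpNorm (fun x => S' i (v x) * g i x) 1 (volume.restrict Ω))
    rw [zero_add] at h2
    have h3 := h2.eventually_lt_const (u := a i)
      (by rw [eLpNorm_one_eq_lintegral_enorm]; exact ha i)
    filter_upwards [h3] with j hj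
    refine le_trans ?_ hj.le
    rw [← eLpNorm_one_eq_lintegral_enorm]
    have hm : AEStronglyMeasurable (fun x => S' i (v x) * g i x) (volume.restrict Ω) :=
      ((hS' i).comp_aestronglyMeasurable h.memLp.aestronglyMeasurable).mul
        (h.memLp_grad i).aestronglyMeasurable
    have hm' : AEStronglyMeasurable (fun x => S' i (φ j x) * pderiv i (φ j) x)
        (volume.restrict Ω) :=
      (((hS' i).comp (hφ j).continuous).mul ((hφ j).continuous_pderiv i)).aestronglyMeasurable
    have h4 := eLpNorm_add_le (hm'.sub hm) hm le_rfl
    rwa [sub_add_cancel] at h4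
  have ha0 : ∀ i, a i ≠ 0 := fun i => (zero_le.trans_lt (ha i)).ne'
  have hbd : ∀ᶠ j in atTop, ∫⁻ x in Ω, ∏ i, ‖S i (φ j x)‖ₑ ^ (1 / ((n : ℝ) - 1)) ≤
      (n : ℝ≥0∞) ^ ((n : ℝ) / (n - 1)) * ∏ i, a i ^ (1 / ((n : ℝ) - 1)) := by
    filter_upwards [eventually_all.2 hev] with j hj
    exact (hφ j).lintegral_prod_le hn hΩ hS hS' hS0 ha0 hat hj
  -- The integrand of the limit is a pointwise `liminf`, so Fatou's lemma concludes.
  have hlim : ∀ᵐ x ∂(volume.restrict Ω), ∏ i, ‖S i (v x)‖ₑ ^ (1 / ((n : ℝ) - 1)) =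
      liminf (fun j => ∏ i, ‖S i (φ j x)‖ₑ ^ (1 / ((n : ℝ) - 1))) atTop := by
    filter_upwards [hae] with x hx
    refine (Tendsto.liminf_eq ?_).symm
    refine ENNReal.tendsto_finsetProd_of_ne_top _ (fun i _ => ?_) fun i _ => ?_
    · exact ((ENNReal.continuous_rpow_const).tendsto _).comp
        ((((hSc i).tendsto _).comp hx).enorm)
    · exact ENNReal.rpow_ne_top_of_nonneg hr enorm_ne_top
  rw [lintegral_congr_ae hlim]
  refine (lintegral_liminf_le fun j => ?_).trans ?_
  · exact Finset.measurable_prod _ fun i _ =>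
      (((hSc i).comp (hφ j).continuous).measurable.enorm).pow_const _
  · exact liminf_le_of_frequently_le' hbd.frequently

/-- The derivative of the power `|σ|^(s-1) σ`, continued by a constant outside `[-k, k]`. -/
noncomputable def cutPowDeriv (k s σ : ℝ) : ℝ := s * min |σ| k ^ (s - 1)

/-- The power `|σ|^(s-1) σ`, continued affinely outside `[-k, k]`. -/
noncomputable def cutPow (k s σ : ℝ) : ℝ := ∫ t in (0 : ℝ)..σ, cutPowDeriv k s t

lemma continuous_cutPowDeriv {k s : ℝ} (hs : 1 ≤ s) : Continuous (cutPowDeriv k s) := by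
  unfold cutPowDeriv
  exact continuous_const.mul
    ((continuous_abs.min continuous_const).rpow_const fun _ => Or.inr (by linarith))

lemma hasDerivAt_cutPow {k s : ℝ} (hs : 1 ≤ s) (σ : ℝ) :
    HasDerivAt (cutPow k s) (cutPowDeriv k s σ) σ :=
  ((continuous_cutPowDeriv hs).integral_hasStrictDerivAt 0 σ).hasDerivAt

lemma abs_cutPowDeriv_le {k s : ℝ} (hk : 0 ≤ k) (hs : 1 ≤ s) (σ : ℝ) :
    |cutPowDeriv k s σ| ≤ s * k ^ (s - 1) := by
  have h0 : 0 ≤ min |σ| k := le_min (abs_nonneg _) hk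
  rw [cutPowDeriv, abs_of_nonneg (mul_nonneg (by linarith) (Real.rpow_nonneg h0 _))]
  exact mul_le_mul_of_nonneg_left
    (Real.rpow_le_rpow h0 (min_le_right _ _) (by linarith)) (by linarith)

lemma cutPow_of_nonneg {k s σ : ℝ} (hs : 1 ≤ s) (h0 : 0 ≤ σ) (h : σ ≤ k) :
    cutPow k s σ = σ ^ s := by
  have h1 : cutPow k s σ = ∫ t in (0 : ℝ)..σ, s * t ^ (s - 1) := by
    refine intervalIntegral.integral_congr fun t ht => ?_
    rw [Set.uIcc_of_le h0] at ht
    simp only [cutPowDeriv]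
    rw [abs_of_nonneg ht.1, min_eq_left (ht.2.trans h)]
  rw [h1, intervalIntegral.integral_const_mul, integral_rpow (Or.inl (by linarith)),
    sub_add_cancel, Real.zero_rpow (by linarith), sub_zero]
  field_simp

lemma cutPow_neg (k s σ : ℝ) : cutPow k s (-σ) = -cutPow k s σ := by
  have h := intervalIntegral.integral_comp_neg (a := 0) (b := σ) (cutPowDeriv k s)
  have h1 : ∀ t, cutPowDeriv k s (-t) = cutPowDeriv k s t := fun t => by
    simp [cutPowDeriv]
  simp only [h1, neg_zero] at h
  rw [cutPow, cutPow, h, intervalIntegral.integral_symm]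

lemma abs_cutPow {k s σ : ℝ} (hs : 1 ≤ s) (h : |σ| ≤ k) : |cutPow k s σ| = |σ| ^ s := by
  rcases le_total 0 σ with h0 | h0
  · rw [abs_of_nonneg h0] at h ⊢
    rw [cutPow_of_nonneg hs h0 h, abs_of_nonneg (Real.rpow_nonneg h0 _)]
  · rw [abs_of_nonpos h0] at h ⊢
    have h1 := cutPow_of_nonneg hs (by linarith : 0 ≤ -σ) h
    rw [cutPow_neg] at h1
    rw [← abs_neg, h1, abs_of_nonneg (Real.rpow_nonneg (by linarith) _)]

/-- The constant in the anisotropic Sobolev inequality, with `S = ∑ 1 / pᵢ`. -/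
noncomputable def sobolevConst (n : ℕ) (p : Fin n → ℝ) (S : ℝ) : ℝ :=
  ((n : ℝ) ^ ((n : ℝ) / (n - 1)) *
    ∏ i, (2 * (1 + n / (S - 1) * (1 - 1 / p i))) ^ (1 / ((n : ℝ) - 1))) ^ (((n : ℝ) - 1) / (S - 1))

/-- Anisotropic Sobolev inequality for bounded functions, with `S = ∑ 1 / pᵢ`. -/
theorem MemW11Zero.lintegral_rpow_le {v : Rn n → ℝ} {g : Fin n → Rn n → ℝ}
    (h : MemW11Zero Ω v g) (hΩ : MeasurableSet Ω) (hΩf : volume Ω ≠ ⊤) {p : Fin n → ℝ}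
    (hp : ∀ i, 1 < p i) {S : ℝ} (hS : S = ∑ i, 1 / p i) (hS1 : 1 < S) {k : ℝ}
    (hvk : ∀ x, |v x| ≤ k) {A : ℝ} (hA : 0 < A)
    (hgA : ∀ i, ∫⁻ x in Ω, ‖g i x‖ₑ ^ p i ≤ ENNReal.ofReal A) :
    ∫⁻ x in Ω, ‖v x‖ₑ ^ ((n : ℝ) / (S - 1)) ≤
      ENNReal.ofReal (sobolevConst n p S * A ^ (S / (S - 1))) := by
  have hSn : S ≤ n := by
    rw [hS]
    calc ∑ i, 1 / p i ≤ ∑ i : Fin n, 1 :=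
          Finset.sum_le_sum fun i _ => by
            rw [div_le_one (by linarith [hp i])]; exact (hp i).le
      _ = n := by simp
  have hn1 : (1 : ℝ) < n := hS1.trans_le hSn
  have hn : 2 ≤ n := by exact_mod_cast hn1
  have hk : 0 ≤ k := (abs_nonneg _).trans (hvk 0)
  set P : ℝ := n / (S - 1) with hP
  have hP0 : 0 < P := div_pos (by linarith) (by linarith)
  set r : ℝ := 1 / ((n : ℝ) - 1) with hr
  have hr0 : 0 < r := one_div_pos.2 (by linarith)
  set s : Fin n → ℝ := fun i => 1 + P * (1 - 1 / p i) with hs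
  have hq : ∀ i, 0 < 1 - 1 / p i := fun i => by
    rw [sub_pos, div_lt_one (by linarith [hp i])]; exact hp i
  have hs1 : ∀ i, 1 ≤ s i := fun i => by
    have := mul_pos hP0 (hq i)
    simp only [hs]; linarith
  have hsum : ∑ i, (1 - 1 / p i) = n - S := by
    rw [Finset.sum_sub_distrib, ← hS]; simp
  set X := ∫⁻ x in Ω, ‖v x‖ₑ ^ P with hX
  -- Finiteness of `X`, which permits the absorption at the end, is where boundedness of `v` and
  -- finite measure enter.
  have hXt : X ≠ ⊤ := by
    refine ne_top_of_le_ne_top (b := ENNReal.ofReal k ^ P * volume Ω)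
      (ENNReal.mul_ne_top (ENNReal.rpow_ne_top_of_nonneg hP0.le ENNReal.ofReal_ne_top) hΩf) ?_
    rw [← setLIntegral_const]
    refine lintegral_mono fun x => ENNReal.rpow_le_rpow ?_ hP0.le
    rw [Real.enorm_eq_ofReal_abs]
    exact ENNReal.ofReal_le_ofReal (hvk x)
  rcases eq_or_ne X 0 with hX0 | hX0
  · rw [hX0]; exact zero_le
  set x := X.toReal with hx
  have hx0 : 0 < x := ENNReal.toReal_pos hX0 hXt
  have hXx : X = ENNReal.ofReal x := (ENNReal.ofReal_toReal hXt).symm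
  set a : Fin n → ℝ := fun i => s i * (x ^ (1 - 1 / p i) * A ^ (1 / p i)) with ha
  have ha0 : ∀ i, 0 < a i := fun i =>
    mul_pos (by linarith [hs1 i]) (mul_pos (Real.rpow_pos_of_pos hx0 _)
      (Real.rpow_pos_of_pos hA _))
  have hhol : ∀ i, ∫⁻ y in Ω, ‖cutPowDeriv k (s i) (v y) * g i y‖ₑ ≤ ENNReal.ofReal (a i) := by
    intro i
    have hpi : 0 < p i := by linarith [hp i]
    have hconj : Real.HolderConjugate (1 / (1 - 1 / p i)) (p i) := by
      rw [Real.holderConjugate_iff]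
      refine ⟨?_, ?_⟩
      · rw [lt_div_iff₀ (hq i)]
        have : 0 < 1 / p i := by positivity
        linarith
      · rw [one_div, inv_inv, one_div]; ring
    have h1 : ∀ y, ‖cutPowDeriv k (s i) (v y) * g i y‖ₑ =
        ENNReal.ofReal (s i) * ((fun y => ‖v y‖ₑ ^ (P * (1 - 1 / p i))) * fun y => ‖g i y‖ₑ) y := by
      intro y
      simp only [Pi.mul_apply]
      rw [enorm_mul, ← mul_assoc, cutPowDeriv, min_eq_left (hvk y), enorm_mul,
        Real.enorm_of_nonneg (by linarith [hs1 i]),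
        Real.enorm_of_nonneg (Real.rpow_nonneg (abs_nonneg _) _), Real.enorm_eq_ofReal_abs (v y),
        ENNReal.ofReal_rpow_of_nonneg (abs_nonneg _) (mul_pos hP0 (hq i)).le]
      simp [hs]
    simp_rw [h1]
    rw [lintegral_const_mul' _ _ ENNReal.ofReal_ne_top, ha, ENNReal.ofReal_mul (by linarith [hs1 i])]
    gcongr
    have hvm := h.memLp.aestronglyMeasurable.enorm
    refine (ENNReal.lintegral_mul_le_Lp_mul_Lq _ hconj (hvm.pow_const _)
      (h.memLp_grad i).aestronglyMeasurable.enorm).trans ?_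
    rw [ENNReal.ofReal_mul (Real.rpow_nonneg hx0.le _), ← ENNReal.ofReal_rpow_of_pos hx0,
      ← ENNReal.ofReal_rpow_of_pos hA, one_div_one_div]
    refine mul_le_mul' ?_ ?_
    · refine ENNReal.rpow_le_rpow ?_ (hq i).le
      rw [← hXx, hX]
      refine lintegral_mono fun y => ?_
      rw [← ENNReal.rpow_mul]
      refine le_of_eq ?_
      rw [mul_assoc, mul_one_div_cancel (hq i).ne', mul_one]
    · exact ENNReal.rpow_le_rpow (hgA i) (by positivity)
  obtain ⟨K, hK⟩ : ∃ K : ℝ, ∀ i, s i * k ^ (s i - 1) ≤ K :=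
    ⟨∑ i, s i * k ^ (s i - 1), fun i => Finset.single_le_sum (f := fun i => s i * k ^ (s i - 1))
      (fun i _ => mul_nonneg (by linarith [hs1 i]) (Real.rpow_nonneg hk _)) (Finset.mem_univ i)⟩
  -- The factor `2` in `2 * a i` only serves to make the required inequality strict.
  have hmain := h.lintegral_prod_le hn hΩ (S := fun i => cutPow k (s i))
    (S' := fun i => cutPowDeriv k (s i)) (K := K) (fun i => hasDerivAt_cutPow (hs1 i))
    (fun i => continuous_cutPowDeriv (hs1 i))
    (fun i σ => (abs_cutPowDeriv_le hk (hs1 i) σ).trans (hK i))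
    (fun i => intervalIntegral.integral_same)
    (a := fun i => ENNReal.ofReal (2 * a i)) (fun i => ENNReal.ofReal_ne_top) fun i =>
      (hhol i).trans_lt ((ENNReal.ofReal_lt_ofReal_iff (by linarith [ha0 i])).2
        (by linarith [ha0 i]))
  have hl : ∀ y, ∏ i, ‖cutPow k (s i) (v y)‖ₑ ^ r = ‖v y‖ₑ ^ P := by
    intro y
    have h1 : ∀ i, ‖cutPow k (s i) (v y)‖ₑ ^ r = ENNReal.ofReal (|v y| ^ (s i * r)) := fun i => by
      rw [Real.enorm_eq_ofReal_abs, abs_cutPow (hs1 i) (hvk y),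
        ENNReal.ofReal_rpow_of_nonneg (Real.rpow_nonneg (abs_nonneg _) _) hr0.le,
        Real.rpow_mul (abs_nonneg _)]
    have h2 : ∑ i, s i * r = P := by
      rw [← Finset.sum_mul]
      simp only [hs]
      rw [Finset.sum_add_distrib, ← Finset.mul_sum, hsum]
      simp only [Finset.sum_const, Finset.card_univ, Fintype.card_fin, nsmul_eq_mul, mul_one, hr,
        hP]
      have : S - 1 ≠ 0 := by linarith
      have : (n : ℝ) - 1 ≠ 0 := by linarith
      field_simp
      ring
    simp_rw [h1]
    rw [← ENNReal.ofReal_prod_of_nonneg fun i _ => Real.rpow_nonneg (abs_nonneg _) _,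
      ← Real.rpow_sum_of_nonneg (abs_nonneg _) fun i _ =>
        mul_nonneg (by linarith [hs1 i]) hr0.le, h2,
      Real.enorm_eq_ofReal_abs, ENNReal.ofReal_rpow_of_nonneg (abs_nonneg _) hP0.le]
  simp_rw [← hr, hl] at hmain
  rw [← hX, hXx] at hmain
  set D : ℝ := (n : ℝ) ^ ((n : ℝ) / (n - 1)) * ∏ i, (2 * s i) ^ r with hD
  have hD0 : 0 ≤ D := mul_nonneg (by positivity)
    (Finset.prod_nonneg fun i _ => Real.rpow_nonneg (by linarith [hs1 i]) _)
  have hreal : x ≤ D * (x ^ ((n - S) * r) * A ^ (S * r)) := by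
    have h1 : ∀ i, ENNReal.ofReal (2 * a i) ^ r =
        ENNReal.ofReal ((2 * s i) ^ r * (x ^ ((1 - 1 / p i) * r) * A ^ ((1 / p i) * r))) := by
      intro i
      rw [ENNReal.ofReal_rpow_of_pos (by linarith [ha0 i])]
      congr 1
      simp only [ha]
      rw [← mul_assoc, Real.mul_rpow (by linarith [hs1 i]) (by positivity),
        Real.mul_rpow (x := x ^ _) (by positivity) (by positivity), Real.rpow_mul hx0.le, Real.rpow_mul hA.le]
    have h0 : ∀ i, 0 ≤ (2 * s i) ^ r := fun i => Real.rpow_nonneg (by linarith [hs1 i]) _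
    simp_rw [h1] at hmain
    rw [← ENNReal.ofReal_prod_of_nonneg
      fun i _ => mul_nonneg (h0 i) (by positivity),
      Finset.prod_mul_distrib, Finset.prod_mul_distrib,
      ← Real.rpow_sum_of_pos hx0, ← Real.rpow_sum_of_pos hA,
      ← Finset.sum_mul, ← Finset.sum_mul, hsum, ← hS, ← ENNReal.ofReal_natCast,
      ENNReal.ofReal_rpow_of_pos (by linarith), ← ENNReal.ofReal_mul (by positivity),
      ← mul_assoc] at hmain
    exact (ENNReal.ofReal_le_ofReal_iff (mul_nonneg hD0 (by positivity))).1 hmain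
  rw [hXx]
  refine ENNReal.ofReal_le_ofReal ?_
  have hS1' : 0 < S - 1 := by linarith
  have hn1' : 0 < (n : ℝ) - 1 := by linarith
  -- Absorption: the exponent `(n - S) r = 1 - (S - 1) r` of `x` on the right of `hreal` is less
  -- than `1`, so that power can be cancelled.
  have h1 : x ^ ((S - 1) * r) ≤ D * A ^ (S * r) := by
    have h2 : x = x ^ ((S - 1) * r) * x ^ ((n - S) * r) := by
      rw [← Real.rpow_add hx0, ← add_mul, hr]
      have : ((S - 1 + (n - S)) * (1 / ((n : ℝ) - 1))) = 1 := by field_simp; ring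
      rw [this, Real.rpow_one]
    have h3 : 0 < x ^ ((n - S) * r) := Real.rpow_pos_of_pos hx0 _
    refine le_of_mul_le_mul_right ?_ h3
    rw [← h2]
    linarith
  have h4 : x = (x ^ ((S - 1) * r)) ^ (((n : ℝ) - 1) / (S - 1)) := by
    rw [← Real.rpow_mul hx0.le, hr]
    have : (S - 1) * (1 / ((n : ℝ) - 1)) * (((n : ℝ) - 1) / (S - 1)) = 1 := by field_simp
    rw [this, Real.rpow_one]
  calc x = (x ^ ((S - 1) * r)) ^ (((n : ℝ) - 1) / (S - 1)) := h4
    _ ≤ (D * A ^ (S * r)) ^ (((n : ℝ) - 1) / (S - 1)) :=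
        Real.rpow_le_rpow (by positivity) h1 (by positivity)
    _ = sobolevConst n p S * A ^ (S / (S - 1)) := by
        rw [Real.mul_rpow hD0 (by positivity), ← Real.rpow_mul hA.le, sobolevConst]
        congr 2
        rw [hr]; field_simp

/-! ### The energy estimate -/

lemma isTestFunction_zero (Ω : Set (Rn n)) : IsTestFunction Ω 0 :=
  ⟨contDiff_const, HasCompactSupport.zero, by simp [tsupport]⟩

lemma hasWeakDeriv_zero (i : Fin n) : HasWeakDeriv Ω i 0 0 where
  locallyIntegrable := (locallyIntegrable_zero).locallyIntegrableOn _
  locallyIntegrable_deriv := (locallyIntegrable_zero).locallyIntegrableOn _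
  integral_eq φ _ := by simp

lemma pderiv_zero (i : Fin n) : pderiv i (0 : Rn n → ℝ) = 0 := by
  ext x
  simp [pderiv]

lemma memW1pZero_zero (p : Fin n → ℝ) : MemW1pZero Ω p 0 0 where
  memW11Zero :=
    { memLp := MemLp.zero
      memLp_grad := fun _ => MemLp.zero
      hasWeakDeriv := hasWeakDeriv_zero
      approx := ⟨fun _ => 0, fun _ => isTestFunction_zero Ω, by simp, by simp [pderiv_zero]⟩ }
  memLp_grad _ := MemLp.zero

lemma memW1Inf_one (hΩf : volume Ω ≠ ⊤) : MemW1Inf Ω (fun _ => 1) := by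
  have : IsFiniteMeasure (volume.restrict Ω) := ⟨by simpa using hΩf.lt_top⟩
  refine ⟨memLp_const 1, fun i => ⟨0, ⟨?_, ?_, fun ψ hψ => ?_⟩, MemLp.zero⟩⟩
  · exact (locallyIntegrable_const 1).locallyIntegrableOn _
  · exact (locallyIntegrable_zero).locallyIntegrableOn _
  · have := integral_comp_mul_pderiv (S := fun _ => 1) (S' := fun _ => 0)
      (fun σ => hasDerivAt_const σ 1) continuous_const (isTestFunction_zero Ω) hψ i
    simpa using this

lemma isRenormalization_trunc {k : ℝ} (hk : 0 < k) : IsRenormalization (trunc k) where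
  lipschitz := by
    refine ⟨1, LipschitzWith.of_dist_le_mul fun a b => ?_⟩
    rw [Real.dist_eq, Real.dist_eq, NNReal.coe_one, one_mul, trunc, trunc]
    have h1 := abs_abs_sub_abs_le_abs_sub (k + a) (k + b)
    have h2 := abs_abs_sub_abs_le_abs_sub (k - a) (k - b)
    rw [show k + a - (k + b) = a - b by ring] at h1
    rw [show k - a - (k - b) = -(a - b) by ring, abs_neg] at h2
    rw [abs_le] at h1 h2 ⊢
    constructor <;> linarith [h1.1, h1.2, h2.1, h2.2]
  bounded := ⟨k, fun σ => by rw [abs_trunc hk.le]; exact min_le_right _ _⟩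
  zero := trunc_of_abs_le (by simpa using hk.le)
  deriv_zero := by
    -- The threshold is `k + 1` rather than `k`, since `T_k` is not differentiable at `±k`.
    refine ⟨k + 1, by linarith, fun σ hσ => ?_⟩
    have h1 : ¬ |σ| < k := by linarith
    have h2 := hasDerivAt_trunc (k := k) (σ := σ) hk.le
      (fun h => by rw [h, abs_of_pos hk] at hσ; linarith)
      (fun h => by rw [h, abs_neg, abs_of_pos hk] at hσ; linarith)
    rwa [Set.indicator_of_notMem (by exact h1)] at h2

/-- Both factors have the sign of `σ`. This is what allows the potential term to be dropped from the
energy identity. -/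
lemma trunc_mul_nonneg {W : ℝ → ℝ} (hW : Monotone W) (hW0 : W 0 = 0) {k : ℝ} (hk : 0 ≤ k)
    (σ : ℝ) : 0 ≤ W σ * trunc k σ := by
  rcases le_total 0 σ with h | h
  · refine mul_nonneg (hW0 ▸ hW h) ?_
    rw [trunc]
    have h1 : |k - σ| ≤ k + σ := abs_le.2 ⟨by linarith, by linarith⟩
    rw [abs_of_nonneg (by linarith : 0 ≤ k + σ)]
    linarith
  · refine mul_nonneg_of_nonpos_of_nonpos (hW0 ▸ hW h) ?_
    rw [trunc]
    have h1 : |k + σ| ≤ k - σ := abs_le.2 ⟨by linarith, by linarith⟩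
    rw [abs_of_nonneg (by linarith : 0 ≤ k - σ)]
    linarith

lemma flux_mul_indicator (p : Fin n → ℝ) (hp : ∀ i, 1 < p i) (i : Fin n) (s : Set (Rn n))
    (G : Rn n → ℝ) (x : Rn n) :
    flux p i (G x) * s.indicator G x = |s.indicator G x| ^ p i := by
  have hpi := hp i
  by_cases hx : x ∈ s
  · rw [Set.indicator_of_mem hx, flux]
    -- The exponent `p i - 2` may be negative, so the zeros of `G` are treated apart.
    rcases eq_or_ne (G x) 0 with h0 | h0
    · rw [h0, mul_zero, abs_zero, Real.zero_rpow (by linarith)]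
    · have h1 : 0 < |G x| := abs_pos.2 h0
      rw [mul_assoc, ← abs_mul_abs_self, ← pow_two, ← Real.rpow_natCast, ← Real.rpow_add h1]
      norm_num
  · rw [Set.indicator_of_notMem hx, mul_zero, abs_zero, Real.zero_rpow (by linarith)]

/-- The energy estimate: testing with `T_k(u)`. -/
theorem IsEntropicRenormalizedSolution.energy_le {p : Fin n → ℝ} {V : Rn n → ℝ → ℝ}
    {f u : Rn n → ℝ} (h : IsEntropicRenormalizedSolution Ω p V f u) (hΩ : IsOpen Ω)
    (hΩf : volume Ω ≠ ⊤) (hp : ∀ i, 1 < p i) (hV : IsPotential Ω V) (hf : IntegrableOn f Ω)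
    {k : ℝ} (hk : 0 < k) (i : Fin n) :
    ∫⁻ x in Ω, ‖{x | |u x| < k}.indicator (genGrad Ω u i) x‖ₑ ^ p i ≤
      ENNReal.ofReal (k * ∫ x in Ω, |f x|) := by
  have hG := h.memTSpace.hasGenGrad_genGrad hΩ hΩf
  have hD : ∀ i, HasWeakDeriv Ω i (fun x => (fun _ => (1 : ℝ)) x * trunc k (u x - (0 : Rn n → ℝ) x))
      ({x | |u x| < k}.indicator (genGrad Ω u i)) := fun i => by
    simpa using (hG i).2 k hk
  obtain ⟨hint, heq⟩ := h.identity (fun _ => 1) 0 (trunc k)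
    (fun i => {x | |u x| < k}.indicator (genGrad Ω u i)) (memW1Inf_one hΩf)
    ⟨0, memW1pZero_zero p⟩ MemLp.zero (isRenormalization_trunc hk) hD
  simp only [flux_mul_indicator p hp, Pi.zero_apply, sub_zero, one_mul] at hint heq
  have hV0 : 0 ≤ ∫ x in Ω, V x (u x) * trunc k (u x) := by
    refine integral_nonneg_of_ae ?_
    filter_upwards [hV.monotone] with x hx
    exact trunc_mul_nonneg hx.2.1 hx.2.2 hk.le (u x)
  have hf1 : ∫ x in Ω, f x * trunc k (u x) ≤ k * ∫ x in Ω, |f x| := by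
    have hb : ∀ x, |trunc k (u x)| ≤ k := fun x => by
      rw [abs_trunc hk.le]; exact min_le_right _ _
    have hI : Integrable (fun x => trunc k (u x) * f x) (volume.restrict Ω) :=
      integrable_mul_of_bound ((continuous_trunc k).comp_aestronglyMeasurable
        h.memTSpace.measurable.aestronglyMeasurable) hb hf
    simp_rw [mul_comm (f _)]
    rw [← integral_const_mul]
    refine integral_mono hI (hf.abs.const_mul k) fun x => ?_
    refine (le_abs_self _).trans ?_
    rw [abs_mul]
    exact mul_le_mul_of_nonneg_right (hb x) (abs_nonneg _)
  have h0 : ∀ x, 0 ≤ ∑ i, |{x | |u x| < k}.indicator (genGrad Ω u i) x| ^ p i := fun x =>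
    Finset.sum_nonneg fun i _ => Real.rpow_nonneg (abs_nonneg _) _
  calc ∫⁻ x in Ω, ‖{x | |u x| < k}.indicator (genGrad Ω u i) x‖ₑ ^ p i
      ≤ ∫⁻ x in Ω,
          ENNReal.ofReal (∑ i, |{x | |u x| < k}.indicator (genGrad Ω u i) x| ^ p i) := by
        refine lintegral_mono fun x => ?_
        rw [Real.enorm_eq_ofReal_abs,
          ENNReal.ofReal_rpow_of_nonneg (abs_nonneg _) (by linarith [hp i])]
        exact ENNReal.ofReal_le_ofReal (Finset.single_le_sum
          (f := fun i => |{x | |u x| < k}.indicator (genGrad Ω u i) x| ^ p i)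
          (fun i _ => Real.rpow_nonneg (abs_nonneg _) _) (Finset.mem_univ i))
    _ = ENNReal.ofReal
          (∫ x in Ω, ∑ i, |{x | |u x| < k}.indicator (genGrad Ω u i) x| ^ p i) :=
        (ofReal_integral_eq_lintegral_ofReal hint (Eventually.of_forall h0)).symm
    _ ≤ _ := ENNReal.ofReal_le_ofReal (by linarith)

/-! ### Level set estimates -/

lemma sobolevConst_nonneg {p : Fin n → ℝ} (hp : ∀ i, 1 < p i) {S : ℝ} (hS1 : 1 < S) :
    0 ≤ sobolevConst n p S := by
  refine Real.rpow_nonneg (mul_nonneg (by positivity) (Finset.prod_nonneg fun i _ => ?_)) _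
  refine Real.rpow_nonneg (mul_nonneg zero_le_two (add_nonneg zero_le_one ?_)) _
  refine mul_nonneg (div_nonneg (by positivity) (by linarith)) ?_
  rw [sub_nonneg, div_le_one (by linarith [hp i])]
  exact (hp i).le

/-- Chebyshev's inequality for `|T_k(u)|^P`, `P = n / (S - 1)`: on `{|u| ≥ k}` this function equals
`k^P`, and its integral is at most `C (k M)^{S/(S-1)}`. The bound `M > 0` stands in for `‖f‖₁`,
which may vanish, since the Sobolev inequality is stated for `A > 0`. -/
theorem IsEntropicRenormalizedSolution.volume_level_le {p : Fin n → ℝ} {V : Rn n → ℝ → ℝ}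
    {f u : Rn n → ℝ} (h : IsEntropicRenormalizedSolution Ω p V f u) (hΩ : IsOpen Ω)
    (hΩf : volume Ω ≠ ⊤) (hp : ∀ i, 1 < p i) (hV : IsPotential Ω V) (hf : IntegrableOn f Ω)
    {S : ℝ} (hS : S = ∑ i, 1 / p i) (hS1 : 1 < S) {M : ℝ} (hM0 : 0 < M)
    (hM : ∫ x in Ω, |f x| ≤ M) {k : ℝ} (hk : 0 < k) :
    volume {x ∈ Ω | k ≤ |u x|} ≤
      ENNReal.ofReal (sobolevConst n p S * M ^ (S / (S - 1)) * k ^ (-((n - S) / (S - 1)))) := by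
  obtain ⟨C, hC⟩ := h.memTSpace.trunc_mem
  obtain ⟨g, hg, -⟩ := hC k hk
  have hb : ∀ x, |trunc k (u x)| ≤ k := fun x => by
    rw [abs_trunc hk.le]; exact min_le_right _ _
  -- The gradient `g` supplied by the `T`-space agrees almost everywhere with the truncated
  -- generalized gradient, so the energy estimate applies to it.
  have hgA : ∀ i, ∫⁻ x in Ω, ‖g i x‖ₑ ^ p i ≤ ENNReal.ofReal (k * M) := fun i => by
    have hae := (hg.memW11Zero.hasWeakDeriv i).ae_eq hΩ
      ((h.memTSpace.hasGenGrad_genGrad hΩ hΩf i).2 k hk)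
    rw [lintegral_congr_ae (g := fun x =>
      ‖{x | |u x| < k}.indicator (genGrad Ω u i) x‖ₑ ^ p i)
      (by filter_upwards [hae] with x hx; rw [hx])]
    exact (h.energy_le hΩ hΩf hp hV hf hk i).trans
      (ENNReal.ofReal_le_ofReal (mul_le_mul_of_nonneg_left hM hk.le))
  have hsob := hg.memW11Zero.lintegral_rpow_le hΩ.measurableSet hΩf hp hS hS1 hb
    (mul_pos hk hM0) hgA
  set P : ℝ := n / (S - 1) with hP
  have hP0 : 0 ≤ P := div_nonneg (by positivity) (by linarith)
  have hcheb := mul_meas_ge_le_lintegral₀ (μ := volume.restrict Ω)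
    (f := fun x => ‖trunc k (u x)‖ₑ ^ P)
    (hg.memW11Zero.memLp.aestronglyMeasurable.enorm.pow_const _) (ENNReal.ofReal (k ^ P))
  have hsub : volume {x ∈ Ω | k ≤ |u x|} ≤
      volume.restrict Ω {x | ENNReal.ofReal (k ^ P) ≤ ‖trunc k (u x)‖ₑ ^ P} := by
    rw [Measure.restrict_apply' hΩ.measurableSet]
    refine measure_mono fun x hx => ⟨?_, hx.1⟩
    change ENNReal.ofReal (k ^ P) ≤ ‖trunc k (u x)‖ₑ ^ P
    rw [Real.enorm_eq_ofReal_abs, ENNReal.ofReal_rpow_of_nonneg (abs_nonneg _) hP0,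
      abs_trunc hk.le, min_eq_right hx.2]
  have hkP : 0 < k ^ P := Real.rpow_pos_of_pos hk _
  have h1 : ENNReal.ofReal (k ^ P) * volume {x ∈ Ω | k ≤ |u x|} ≤
      ENNReal.ofReal (sobolevConst n p S * (k * M) ^ (S / (S - 1))) :=
    ((mul_le_mul_right hsub _).trans hcheb).trans hsob
  rw [mul_comm, ← ENNReal.le_div_iff_mul_le (Or.inl (by simpa using hkP))
    (Or.inl ENNReal.ofReal_ne_top), ← ENNReal.ofReal_div_of_pos hkP] at h1
  refine h1.trans (le_of_eq ?_)
  congr 1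
  rw [Real.mul_rpow hk.le hM0.le, show -(((n : ℝ) - S) / (S - 1)) = S / (S - 1) - P by
    rw [hP]; ring, Real.rpow_sub hk]
  ring

theorem IsEntropicRenormalizedSolution.volume_grad_le {p : Fin n → ℝ} {V : Rn n → ℝ → ℝ}
    {f u : Rn n → ℝ} (h : IsEntropicRenormalizedSolution Ω p V f u) (hΩ : IsOpen Ω)
    (hΩf : volume Ω ≠ ⊤) (hp : ∀ i, 1 < p i) (hV : IsPotential Ω V) (hf : IntegrableOn f Ω)
    {S : ℝ} (hS : S = ∑ i, 1 / p i) (hS1 : 1 < S) (hSn : S < n) {M : ℝ} (hM0 : 0 < M)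
    (hM : ∫ x in Ω, |f x| ≤ M) (i : Fin n) {t : ℝ} (ht : 0 < t) :
    volume {x ∈ Ω | t < |genGrad Ω u i x|} ≤
      ENNReal.ofReal ((sobolevConst n p S + 1) * M ^ ((n : ℝ) / (n - 1)) *
        t ^ (-(p i * (n - S) / (n - 1)))) := by
  have hpi := hp i
  have hn1 : 0 < (n : ℝ) - 1 := by linarith
  have hS1' : 0 < S - 1 := by linarith
  -- This level equates the powers of `M` and `t` in the two bounds `M^{S/(S-1)} k^{-(n-S)/(S-1)}`
  -- and `k M / t^{pᵢ}`; both become `M^{n/(n-1)} t^{-pᵢ(n-S)/(n-1)}`, whence the constant `C + 1`.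
  set k : ℝ := M ^ (1 / ((n : ℝ) - 1)) * t ^ (p i * (S - 1) / (n - 1)) with hk
  have hk0 : 0 < k := mul_pos (Real.rpow_pos_of_pos hM0 _) (Real.rpow_pos_of_pos ht _)
  have hlev := h.volume_level_le hΩ hΩf hp hV hf hS hS1 hM0 hM hk0
  have hen := (h.energy_le hΩ hΩf hp hV hf hk0 i).trans
    (ENNReal.ofReal_le_ofReal (mul_le_mul_of_nonneg_left hM hk0.le))
  set Gk := {x | |u x| < k}.indicator (genGrad Ω u i) with hGk
  have hmeas : AEMeasurable Gk (volume.restrict Ω) := by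
    obtain ⟨C, hC⟩ := h.memTSpace.trunc_mem
    obtain ⟨g, hg, -⟩ := hC k hk0
    exact (hg.memW11Zero.memLp_grad i).aestronglyMeasurable.aemeasurable.congr
      ((hg.memW11Zero.hasWeakDeriv i).ae_eq hΩ
        ((h.memTSpace.hasGenGrad_genGrad hΩ hΩf i).2 k hk0))
  have hcheb := mul_meas_ge_le_lintegral₀ (μ := volume.restrict Ω)
    (f := fun x => ‖Gk x‖ₑ ^ p i) (hmeas.enorm.pow_const _) (ENNReal.ofReal (t ^ p i))
  have hsub : {x ∈ Ω | t < |genGrad Ω u i x|} ⊆ {x ∈ Ω | k ≤ |u x|} ∪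
      ({x | ENNReal.ofReal (t ^ p i) ≤ ‖Gk x‖ₑ ^ p i} ∩ Ω) := by
    rintro x ⟨hxΩ, hx⟩
    by_cases hux : |u x| < k
    · refine Or.inr ⟨?_, hxΩ⟩
      change ENNReal.ofReal (t ^ p i) ≤ ‖Gk x‖ₑ ^ p i
      rw [Real.enorm_eq_ofReal_abs, ENNReal.ofReal_rpow_of_nonneg (abs_nonneg _) (by linarith),
        hGk, Set.indicator_of_mem (by exact hux)]
      exact ENNReal.ofReal_le_ofReal (Real.rpow_le_rpow ht.le hx.le (by linarith))
    · exact Or.inl ⟨hxΩ, not_lt.1 hux⟩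
  have htp : 0 < t ^ p i := Real.rpow_pos_of_pos ht _
  have h2 : volume ({x | ENNReal.ofReal (t ^ p i) ≤ ‖Gk x‖ₑ ^ p i} ∩ Ω) ≤
      ENNReal.ofReal (k * M / t ^ p i) := by
    rw [← Measure.restrict_apply' hΩ.measurableSet, ENNReal.ofReal_div_of_pos htp,
      ENNReal.le_div_iff_mul_le (Or.inl (by simpa using htp)) (Or.inl ENNReal.ofReal_ne_top),
      mul_comm]
    exact hcheb.trans hen
  have hC0 := sobolevConst_nonneg hp hS1
  calc volume {x ∈ Ω | t < |genGrad Ω u i x|} ≤ _ := measure_mono hsub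
    _ ≤ _ := measure_union_le _ _
    _ ≤ _ := add_le_add hlev h2
    _ = _ := by
      rw [← ENNReal.ofReal_add (by positivity) (by positivity)]
      congr 1
      have e1 : M ^ (S / (S - 1)) * k ^ (-((n - S) / (S - 1))) =
          M ^ ((n : ℝ) / (n - 1)) * t ^ (-(p i * (n - S) / (n - 1))) := by
        rw [hk, Real.mul_rpow (by positivity) (by positivity), ← Real.rpow_mul hM0.le,
          ← Real.rpow_mul ht.le, ← mul_assoc, ← Real.rpow_add hM0]
        congr 2
        · field_simp; ring
        · field_simp
      have e2 : k * M / t ^ p i =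
          M ^ ((n : ℝ) / (n - 1)) * t ^ (-(p i * (n - S) / (n - 1))) := by
        have e3 : M ^ ((n : ℝ) / (n - 1)) = M ^ (1 / ((n : ℝ) - 1)) * M := by
          rw [← Real.rpow_add_one hM0.ne']
          congr 1
          field_simp; ring
        have e4 : t ^ (-(p i * (n - S) / (n - 1))) = t ^ (p i * (S - 1) / (n - 1)) / t ^ p i := by
          rw [← Real.rpow_sub ht]
          congr 1
          field_simp; ring
        rw [e3, e4, hk]; ring
      rw [mul_assoc, e1, e2]; ring

/-! ### Weak norms -/

lemma weakNorm_le {v : Rn n → ℝ} {N Q : ℝ} (hN : 0 < N) (hQ : 0 < Q)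
    (h : ∀ t, 0 < t → volume {x ∈ Ω | t < |v x|} ≤ ENNReal.ofReal ((N / t) ^ Q)) :
    weakNorm Ω Q v ≤ ENNReal.ofReal N := by
  refine iSup₂_le fun t ht => ?_
  calc ENNReal.ofReal t * volume {x ∈ Ω | t < |v x|} ^ (1 / Q)
      ≤ ENNReal.ofReal t * ENNReal.ofReal ((N / t) ^ Q) ^ (1 / Q) := by
        gcongr; exact h t ht
    _ = ENNReal.ofReal N := by
        rw [ENNReal.ofReal_rpow_of_nonneg (by positivity) (by positivity),
          ← Real.rpow_mul (by positivity), mul_one_div_cancel hQ.ne', Real.rpow_one,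
          ← ENNReal.ofReal_mul ht.le, mul_div_cancel₀ _ ht.ne']

/-- At height `N s^{-1/Q}` the distribution function is at most `s`. The factor `2` passes from the
strict level sets of the hypothesis to the non-strict ones in `rearr`. -/
lemma rearr_le {v : Rn n → ℝ} {N Q : ℝ} (hN : 0 < N) (hQ : 0 < Q)
    (h : ∀ t, 0 < t → volume {x ∈ Ω | t < |v x|} ≤ ENNReal.ofReal ((N / t) ^ Q)) {s : ℝ}
    (hs : 0 < s) : rearr Ω v s ≤ ENNReal.ofReal (2 * N * s ^ (-(1 / Q))) := by
  have hsp : 0 < s ^ (-(1 / Q)) := Real.rpow_pos_of_pos hs _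
  refine sInf_le ?_
  have hpos : 0 < N * s ^ (-(1 / Q)) := mul_pos hN hsp
  have he : (N / (N * s ^ (-(1 / Q)))) ^ Q = s := by
    rw [← div_div, div_self hN.ne', Real.rpow_neg hs.le, one_div, inv_inv, ← Real.rpow_mul hs.le,
      one_div_mul_cancel hQ.ne', Real.rpow_one]
  have h1 := h _ hpos
  rw [he] at h1
  refine le_trans (measure_mono ?_) h1
  rintro x ⟨hxΩ, hx⟩
  have h2 := (ENNReal.ofReal_le_ofReal_iff (abs_nonneg _)).1 hx
  exact ⟨hxΩ, by linarith⟩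

/-- For `Q > 1` the bound `2N s^{-1/Q}` on the rearrangement is integrable at `0`; its integral over
`(0, t)` produces the factor `1 / (1 - 1/Q)`. -/
lemma lorentzNorm_le {v : Rn n → ℝ} {N Q : ℝ} (hN : 0 < N) (hQ : 1 < Q)
    (h : ∀ t, 0 < t → volume {x ∈ Ω | t < |v x|} ≤ ENNReal.ofReal ((N / t) ^ Q)) :
    lorentzNorm Ω Q v ≤ ENNReal.ofReal (2 / (1 - 1 / Q) * N) := by
  refine iSup₂_le fun t ht => ?_
  have ht0 := ht.1
  have hQ1 : 1 / Q < 1 := (div_lt_one (by linarith)).2 hQ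
  have hint : IntegrableOn (fun s : ℝ => 2 * N * s ^ (-(1 / Q))) (Set.Ioo 0 t) := by
    refine Integrable.const_mul ?_ _
    have := (intervalIntegral.intervalIntegrable_rpow' (a := 0) (b := t)
      (r := -(1 / Q)) (by linarith)).1
    exact this.mono_set Set.Ioo_subset_Ioc_self
  have hval : ∫ s in Set.Ioo 0 t, 2 * N * s ^ (-(1 / Q)) =
      2 * N * (t ^ (1 - 1 / Q) / (1 - 1 / Q)) := by
    rw [← integral_Ioc_eq_integral_Ioo, ← intervalIntegral.integral_of_le ht0.le,
      intervalIntegral.integral_const_mul, integral_rpow (Or.inl (by linarith)),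
      show -(1 / Q) + 1 = 1 - 1 / Q by ring, Real.zero_rpow (by linarith), sub_zero]
  have h1 : ∫⁻ s in Set.Ioo 0 t, rearr Ω v s ≤
      ENNReal.ofReal (2 * N * (t ^ (1 - 1 / Q) / (1 - 1 / Q))) := by
    rw [← hval, ofReal_integral_eq_lintegral_ofReal hint
      ((ae_restrict_iff' measurableSet_Ioo).2 (Eventually.of_forall fun s hs =>
        mul_nonneg (by positivity) (Real.rpow_nonneg hs.1.le _)))]
    exact setLIntegral_mono' measurableSet_Ioo fun s hs => rearr_le hN (by linarith) h hs.1
  calc ENNReal.ofReal (t ^ (1 / Q)) * rearrAvg Ω v t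
      ≤ ENNReal.ofReal (t ^ (1 / Q)) * (ENNReal.ofReal (1 / t) *
          ENNReal.ofReal (2 * N * (t ^ (1 - 1 / Q) / (1 - 1 / Q)))) := by
        rw [rearrAvg]; gcongr
    _ = _ := by
        rw [← ENNReal.ofReal_mul (by positivity), ← ENNReal.ofReal_mul (by positivity)]
        congr 1
        rw [Real.rpow_sub ht0, Real.rpow_one]
        have : t ^ (1 / Q) ≠ 0 := (Real.rpow_pos_of_pos ht0 _).ne'
        have : 1 - 1 / Q ≠ 0 := by linarith
        field_simp

/-- The estimates are available for every `M > ‖f‖₁`; letting `M` decrease to `‖f‖₁` includes the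
case `f = 0`. Positivity of `e` gives continuity of the power at `0`. -/
lemma le_ofReal_of_forall_gt {A : ℝ≥0∞} {c F e d : ℝ} (he : 0 < e)
    (h : ∀ M, F < M → A ≤ ENNReal.ofReal (c * M ^ e * d)) : A ≤ ENNReal.ofReal (c * F ^ e * d) := by
  have hc : ContinuousAt (fun M : ℝ => ENNReal.ofReal (c * M ^ e * d)) F :=
    ENNReal.continuous_ofReal.continuousAt.comp
      ((continuousAt_const.mul (Real.continuousAt_rpow_const _ _ (Or.inr he.le))).mul
        continuousAt_const)
  refine ge_of_tendsto (hc.tendsto.mono_left nhdsWithin_le_nhds : Tendsto _ (𝓝[>] F) _) ?_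
  filter_upwards [self_mem_nhdsWithin] with M hM
  exact h M hM

end Anisotropic

/-! ### The theorem: translation of the exponents and choice of the constant -/

open Anisotropic

theorem theorem5p2 {n : ℕ} (Ω : Set (Anisotropic.Rn n)) (hΩo : IsOpen Ω)
    (hΩb : Bornology.IsBounded Ω) (p : Fin n → ℝ) (hp : ∀ i, 1 < p i)
    (hpn : 1 < ∑ i, 1 / p i) (V : Anisotropic.Rn n → ℝ → ℝ)
    (hV : Anisotropic.IsPotential Ω V) :
    ∃ c : ℝ, 0 < c ∧ ∀ f u : Anisotropic.Rn n → ℝ, IntegrableOn f Ω volume →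
      Anisotropic.IsEntropicRenormalizedSolution Ω p V f u →
      (∀ k : ℝ, 0 < k →
        volume {x ∈ Ω | k < |u x|} ≤ ENNReal.ofReal
          (c * (∫ x in Ω, |f x|) ^
              (Anisotropic.sobolevExp n (Anisotropic.hmean p) / Anisotropic.hmean p) *
            k ^ (-(Anisotropic.sobolevExp n (Anisotropic.hmean p) /
              Anisotropic.conjExp (Anisotropic.hmean p))))) ∧
      (∀ i, Anisotropic.weakNorm Ω
          (Anisotropic.conjExp n * p i / Anisotropic.conjExp (Anisotropic.hmean p))
          (Anisotropic.genGrad Ω u i) ≤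
        ENNReal.ofReal
          (c * (∫ x in Ω, |f x|) ^ (Anisotropic.conjExp (Anisotropic.hmean p) / p i))) ∧
      (∀ i, 1 < Anisotropic.conjExp n * p i / Anisotropic.conjExp (Anisotropic.hmean p) →
        Anisotropic.lorentzNorm Ω
          (Anisotropic.conjExp n * p i / Anisotropic.conjExp (Anisotropic.hmean p))
          (Anisotropic.genGrad Ω u i) ≤
        ENNReal.ofReal
          (c * (∫ x in Ω, |f x|) ^ (Anisotropic.conjExp (Anisotropic.hmean p) / p i))) := by
  have hΩf : volume Ω ≠ ⊤ := hΩb.measure_lt_top.ne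
  obtain ⟨S, hS⟩ : ∃ S, S = ∑ i, 1 / p i := ⟨_, rfl⟩
  have hS1 : 1 < S := hS ▸ hpn
  have hn0 : n ≠ 0 := by
    rintro rfl
    simp at hpn
    linarith
  have : NeZero n := ⟨hn0⟩
  have hSn : S < n := by
    rw [hS]
    calc ∑ i, 1 / p i < ∑ i : Fin n, 1 :=
          Finset.sum_lt_sum_of_nonempty Finset.univ_nonempty fun i _ => by
            rw [div_lt_one (by linarith [hp i])]; exact hp i
      _ = n := by simp
  have hn1 : 0 < (n : ℝ) - 1 := by linarith
  have hS1' : 0 < S - 1 := by linarith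
  have hSn' : 0 < (n : ℝ) - S := by linarith
  have hn : 0 < (n : ℝ) := by linarith
  have hm : hmean p = n / S := by rw [hmean, hS]
  have hc' : conjExp (hmean p) = n / (n - S) := by
    rw [hm, conjExp]
    have : (n : ℝ) / S - 1 ≠ 0 := by
      rw [div_sub_one (by linarith)]; exact (div_pos hSn' (by linarith)).ne'
    field_simp
  have hs : sobolevExp n (hmean p) = n / (S - 1) := by
    rw [hm, sobolevExp]
    have : (n : ℝ) - n / S ≠ 0 := by
      rw [show (n : ℝ) - n / S = n * (S - 1) / S by field_simp]
      positivity
    field_simp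
  have e1 : sobolevExp n (hmean p) / hmean p = S / (S - 1) := by
    rw [hs, hm]; field_simp
  have e2 : sobolevExp n (hmean p) / conjExp (hmean p) = (n - S) / (S - 1) := by
    rw [hs, hc']; field_simp
  have e3 : ∀ i, conjExp n * p i / conjExp (hmean p) = p i * (n - S) / (n - 1) := fun i => by
    rw [hc', conjExp]; field_simp
  have e4 : ∀ i, conjExp (hmean p) / p i = n / ((n - S) * p i) := fun i => by
    rw [hc', div_div]
  simp only [e1, e2, e3, e4]
  set C := sobolevConst n p S with hC
  have hC0 : 0 ≤ C := sobolevConst_nonneg hp hS1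
  set Q : Fin n → ℝ := fun i => p i * (n - S) / (n - 1) with hQ
  have hQ0 : ∀ i, 0 < Q i := fun i =>
    div_pos (mul_pos (by linarith [hp i]) hSn') hn1
  -- Chosen so that `(N i)^{Q i} = C + 1`, which turns the gradient estimate into the form `(N i M^e
  -- / t)^{Q i}`, with `e = n / ((n - S) p i)` because `e Q i = n / (n - 1)`.
  set N : Fin n → ℝ := fun i => (C + 1) ^ (1 / Q i) with hN
  have hN0 : ∀ i, 0 < N i := fun i => Real.rpow_pos_of_pos (by linarith) _
  -- The absolute value keeps the sum over all `i` nonnegative, although `1 - 1 / Q i` is negative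
  -- for those `i` with `Q i < 1`, where no Lorentz bound is claimed.
  set L : Fin n → ℝ := fun i => |2 / (1 - 1 / Q i) * N i| with hL
  have hsN : 0 ≤ ∑ i, N i := Finset.sum_nonneg fun i _ => (hN0 i).le
  have hsL : 0 ≤ ∑ i, L i := Finset.sum_nonneg fun i _ => abs_nonneg _
  set c := C + 1 + ∑ i, N i + ∑ i, L i with hc
  have hcN : ∀ i, N i ≤ c := fun i => by
    have := Finset.single_le_sum (f := N) (fun i _ => (hN0 i).le) (Finset.mem_univ i)
    linarith
  have hcL : ∀ i, 2 / (1 - 1 / Q i) * N i ≤ c := fun i => by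
    have h1 := Finset.single_le_sum (f := L) (fun i _ => abs_nonneg _) (Finset.mem_univ i)
    have h2 : 2 / (1 - 1 / Q i) * N i ≤ L i := le_abs_self _
    linarith
  refine ⟨c, by linarith, fun f u hf h => ?_⟩
  set F := ∫ x in Ω, |f x| with hF
  have hF0 : 0 ≤ F := integral_nonneg fun x => abs_nonneg _
  have hgrad : ∀ M, F < M → ∀ i, ∀ t, 0 < t → volume {x ∈ Ω | t < |genGrad Ω u i x|} ≤
      ENNReal.ofReal ((N i * M ^ ((n : ℝ) / ((n - S) * p i)) / t) ^ Q i) := by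
    intro M hM i t ht
    have hM0 : 0 < M := hF0.trans_lt hM
    have hpi : 0 < p i := by linarith [hp i]
    refine (h.volume_grad_le hΩo hΩf hp hV hf hS hS1 hSn hM0 hM.le i ht).trans (le_of_eq ?_)
    congr 1
    rw [Real.div_rpow (mul_nonneg (hN0 i).le (by positivity)) ht.le,
      Real.mul_rpow (hN0 i).le (by positivity), ← Real.rpow_mul hM0.le,
      ← Real.rpow_mul (by linarith : 0 ≤ C + 1), one_div_mul_cancel (hQ0 i).ne', Real.rpow_one,
      Real.rpow_neg ht.le, div_eq_mul_inv]
    congr 3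
    simp only [hQ]
    field_simp
  have hep : ∀ i, 0 < (n : ℝ) / ((n - S) * p i) := fun i =>
    div_pos hn (mul_pos hSn' (by linarith [hp i]))
  refine ⟨fun k hk => ?_, fun i => ?_, fun i hi => ?_⟩
  · refine le_ofReal_of_forall_gt (by positivity) fun M hM => ?_
    have hM0 : 0 < M := hF0.trans_lt hM
    have hsub : {x ∈ Ω | k < |u x|} ⊆ {x ∈ Ω | k ≤ |u x|} := fun x hx => ⟨hx.1, hx.2.le⟩
    refine (measure_mono hsub).trans
      ((h.volume_level_le hΩo hΩf hp hV hf hS hS1 hM0 hM.le hk).trans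
        (ENNReal.ofReal_le_ofReal ?_))
    have : C ≤ c := by linarith
    gcongr
  · rw [← mul_one (c * _)]
    refine le_ofReal_of_forall_gt (hep i) fun M hM => ?_
    have hM0 : 0 < M := hF0.trans_lt hM
    refine (weakNorm_le (mul_pos (hN0 i) (Real.rpow_pos_of_pos hM0 _)) (hQ0 i)
      (hgrad M hM i)).trans (ENNReal.ofReal_le_ofReal ?_)
    rw [mul_one]
    exact mul_le_mul_of_nonneg_right (hcN i) (Real.rpow_nonneg hM0.le _)
  · rw [← mul_one (c * _)]
    refine le_ofReal_of_forall_gt (hep i) fun M hM => ?_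
    have hM0 : 0 < M := hF0.trans_lt hM
    refine (lorentzNorm_le (mul_pos (hN0 i) (Real.rpow_pos_of_pos hM0 _)) hi
      (hgrad M hM i)).trans (ENNReal.ofReal_le_ofReal ?_)
    rw [mul_one, ← mul_assoc]
    exact mul_le_mul_of_nonneg_right (hcL i) (Real.rpow_nonneg hM0.le _)
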